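/- Let $U$ and $V$ be separable real Banach spaces with duals $U^*$, $V^*$, and let $(\Omega,\mathcal A,P)$ be a probability space with a filtration $(\mathcal F_t)_{t\ge 0}$. Random variables in $L^0(\Omega)$ and $L^2(\Omega)$ are identified if they are equal almost surely. A *cylindrical random variable* in $U$ is a linear map $X:U^*\to L^0(\Omega)$. An $\mathbb R^n$-valued process $B$ is a *Wiener process* (with respect to $(\mathcal F_t)$) if $B(0)=0$ a.s., $B(t)$ is $\mathcal F_t$-measurable up to null sets, and for all $0\le s\le t$ the increment $B(t)-B(s)$ is independent of $\mathcal F_s$ and normally distributed with mean $0$ and covariance matrix $(t-s)C$ for a fixed symmetric non-negative definite matrix $C$. A *strongly cylindrical Wiener process* in $U$ is a family $W=(W(t))_{t\ge 0}$ of cylindrical random variables in $U$ such that (i) $(W(t)u_1^*,\dots,W(t)u_n^*)_{t\ge 0}$ is a Wiener process in $\mathbb R^n$ for all $n$ and all $u_1^*,\dots,u_n^*\in U^*$; (ii) the cylindrical distribution of $W(1)$ is strongly Gaussian: all $W(1)u^*$ are centred Gaussian and there is $Q:U^*\to U$ (its covariance operator) with $\langle Qu^*,v^*\rangle=\operatorname{Cov}(W(1)u^*,W(1)v^*)$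 for all $u^*,v^*\in U^*$. The operator $Q$ is then linear, bounded, symmetric and positive. Let $H_Q$ be its reproducing kernel Hilbert space, i.e. the completion of the range of $Q$ with respect to $[Qu^*,Qv^*]:=\langle Qu^*,v^*\rangle$, let $i_Q:H_Q\to U$ be the continuous extension of the inclusion of the range of $Q$ into $U$, and $i_Q^*:U^*\to H_Q$ its adjoint. A *representation* of $W$ consists of an orthonormal basis $(e_k)_{k\in K}$ of $H_Q$ with a countable (finite or infinite) index set $K$ and functionals $u_k^*\in U^*$ with $i_Q^*u_k^*=e_k$; put $B_k(t):=W(t)u_k^*$. For $T\ge0$ let $M_T(U,V)$ be the set of all $\Phi:[0,T]\times\Omega\to L(U,V)$ such that for every $v^*\in V^*$, with $\Phi^*(t,\omega)$ the dual operator of $\Phi(t,\omega)$ and $U^*$ carrying the Borel $\sigma$-algebra of its norm: $(t,\omega)\mapsto\Phi^*(t,\omega)v^*$ is $\mathcal B[0,T]\otimes\mathcal A$-measurable; $\omega\mapsto\Phi^*(t,\omega)v^*$ is $\mathcal F_t$-measurable for each $t\in[0,T]$; and $\int_0^T E\|\Phi^*(s)v^*\|_{U^*}^2\,ds<\infty$.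 The real Itô integral $\int_0^t f\,dB\in L^2(\Omega)$ is understood as the $L^2(\Omega)$-limit of the elementary integrals of bounded adapted simple processes converging to $f$ in $L^2([0,t]\times\Omega)$. **Lemma.** Let $W$ be a strongly cylindrical Wiener process in $U$, $\Phi\in M_T(U,V)$ and $t\in[0,T]$. For every representation $(e_k,u_k^*)_{k\in K}$ of $W$: (a) for all $v^*\in V^*$ and $k\in K$ the Itô integral $\int_0^t\langle\Phi(s)i_Qe_k,v^*\rangle\,dB_k(s)$ exists in $L^2(\Omega)$ and is uniquely determined; (b) for all $v^*\in V^*$ the series $$I_t(\Phi)v^*:=\sum_{k\in K}\int_0^t\langle\Phi(s)i_Qe_k,v^*\rangle\,dB_k(s)$$ converges (unconditionally) in $L^2(\Omega)$; (c) $v^*\mapsto I_t(\Phi)v^*$ is linear, so that $I_t(\Phi)$ is a cylindrical random variable in $V$ with values in $L^2(\Omega)$. Moreover, $I_t(\Phi)$ does not depend on the representation: for every $v^*\in V^*$, any two representations of $W$, i.e. any two choices of the basis $(e_k)$ and of the functionals $(u_k^*)$, give the same $I_t(\Phi)v^*\in L^2(\Omega)$. -/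

import Mathlib

open MeasureTheory ProbabilityTheory Filter Topology
open scoped NNReal ENNReal

noncomputable section

namespace CylindricalWiener

/-! ### Symmetric positive operators `Q : U* → U` and their reproducing kernel Hilbert space -/

section RKHS

/-- A bounded linear operator `Q : U* → U` which is symmetric and positive. -/
structure PosSymmOp (U : Type*) [NormedAddCommGroup U] [NormedSpace ℝ U] where
  op : StrongDual ℝ U →L[ℝ] U
  symm : ∀ u v : StrongDual ℝ U, v (op u) = u (op v)
  nonneg : ∀ u : StrongDual ℝ U, 0 ≤ u (op u)

variable {U : Type*} [NormedAddCommGroup U] [NormedSpace ℝ U] (Q : PosSymmOp U)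

/-- The range of `Q`, as a bare vector space: it does not carry the norm inherited from `U`, but
the inner product `[Qu*, Qv*] = ⟨Qu*, v*⟩`. -/
def PosSymmOp.Ran : Type _ := LinearMap.range (Q.op : StrongDual ℝ U →ₗ[ℝ] U)

instance : AddCommGroup Q.Ran :=
  inferInstanceAs (AddCommGroup (LinearMap.range (Q.op : StrongDual ℝ U →ₗ[ℝ] U)))

instance : Module ℝ Q.Ran :=
  inferInstanceAs (Module ℝ (LinearMap.range (Q.op : StrongDual ℝ U →ₗ[ℝ] U)))

/-- The inclusion of the range of `Q` into `U`. -/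
def PosSymmOp.ranIncl : Q.Ran →ₗ[ℝ] U :=
  (LinearMap.range (Q.op : StrongDual ℝ U →ₗ[ℝ] U)).subtype

/-- `Q` as a map onto its range. -/
def PosSymmOp.toRan (u : StrongDual ℝ U) : Q.Ran := ⟨Q.op u, ⟨u, rfl⟩⟩

/-- A preimage of an element of the range of `Q`. -/
def PosSymmOp.lift (x : Q.Ran) : StrongDual ℝ U := Classical.choose x.2

lemma PosSymmOp.op_lift (x : Q.Ran) : Q.op (Q.lift x) = Q.ranIncl x :=
  Classical.choose_spec x.2

lemma PosSymmOp.ranIncl_toRan (u : StrongDual ℝ U) : Q.ranIncl (Q.toRan u) = Q.op u := rfl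

lemma PosSymmOp.ranIncl_injective : Function.Injective Q.ranIncl := Subtype.val_injective

/-- The value `⟨x, v*⟩` does not depend on the choice of `v*` with `Qv* = y`. -/
lemma PosSymmOp.apply_eq_of_op_eq (x : Q.Ran) {v w : StrongDual ℝ U} (h : Q.op v = Q.op w) :
    v (Q.ranIncl x) = w (Q.ranIncl x) := by
  rw [← Q.op_lift x, Q.symm _ v, Q.symm _ w, h]

lemma PosSymmOp.lift_apply_comm (x y : Q.Ran) :
    Q.lift y (Q.ranIncl x) = Q.lift x (Q.ranIncl y) := by
  rw [← Q.op_lift x, Q.symm, Q.op_lift]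

lemma PosSymmOp.cauchy_schwarz (u v : StrongDual ℝ U) :
    (v (Q.op u)) ^ 2 ≤ u (Q.op u) * v (Q.op v) := by
  have h : ∀ r : ℝ, 0 ≤ v (Q.op v) * (r * r) + (2 * v (Q.op u)) * r + u (Q.op u) := by
    intro r
    have h1 := Q.nonneg (u + r • v)
    have h2 := Q.symm u v
    simp only [map_add, map_smul, add_apply, smul_apply, smul_eq_mul] at h1
    rw [← h2] at h1
    nlinarith [h1]
  have h3 := discrim_le_zero h
  rw [discrim] at h3
  nlinarith [h3]

/-- The inner product `[Qu*, Qv*] = ⟨Qu*, v*⟩` on the range of `Q`. -/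
instance PosSymmOp.core : InnerProductSpace.Core ℝ Q.Ran where
  inner x y := Q.lift y (Q.ranIncl x)
  conj_inner_symm x y := by
    simpa using Q.lift_apply_comm y x
  re_inner_nonneg x := by
    simpa [← Q.op_lift x] using Q.nonneg (Q.lift x)
  add_left x y z := by simp
  smul_left x y r := by simp
  definite x hx := by
    have hx' : Q.lift x (Q.op (Q.lift x)) = 0 := by rw [Q.op_lift]; exact hx
    have h0 : ∀ v : StrongDual ℝ U, v (Q.ranIncl x) = 0 := by
      intro v
      have := Q.cauchy_schwarz (Q.lift x) v
      rw [hx', zero_mul, Q.op_lift] at this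
      nlinarith [sq_nonneg (v (Q.ranIncl x))]
    have h1 : Q.ranIncl x = 0 := by
      apply SeparatingDual.eq_zero_of_forall_dual_eq_zero (R := ℝ)
      exact h0
    exact Q.ranIncl_injective (by rw [h1, map_zero])

instance : NormedAddCommGroup Q.Ran := Q.core.toNormedAddCommGroup

instance : InnerProductSpace ℝ Q.Ran := InnerProductSpace.ofCore Q.core.toCore

lemma PosSymmOp.inner_toRan (u v : StrongDual ℝ U) :
    inner ℝ (Q.toRan u) (Q.toRan v) = v (Q.op u) := by
  change Q.lift (Q.toRan v) (Q.ranIncl (Q.toRan u)) = _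
  rw [← Q.ranIncl_toRan u]
  exact Q.apply_eq_of_op_eq _ (by rw [Q.op_lift, Q.ranIncl_toRan])

/-- The reproducing kernel Hilbert space `H_Q`: the completion of the range of `Q` with respect to
`[·,·]`. -/
abbrev PosSymmOp.H : Type _ := UniformSpace.Completion Q.Ran

lemma PosSymmOp.norm_ranIncl_le (x : Q.Ran) : ‖Q.ranIncl x‖ ≤ Real.sqrt ‖Q.op‖ * ‖x‖ := by
  have hx : ‖x‖ ^ 2 = Q.lift x (Q.op (Q.lift x)) := by
    rw [← real_inner_self_eq_norm_sq, Q.op_lift]; rfl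
  apply NormedSpace.norm_le_dual_bound ℝ _ (by positivity)
  intro v
  have h1 := Q.cauchy_schwarz (Q.lift x) v
  rw [← hx, Q.op_lift] at h1
  have h2 : v (Q.op v) ≤ ‖Q.op‖ * ‖v‖ ^ 2 := by
    calc v (Q.op v) ≤ ‖v (Q.op v)‖ := le_abs_self _
      _ ≤ ‖v‖ * ‖Q.op v‖ := v.le_opNorm _
      _ ≤ ‖v‖ * (‖Q.op‖ * ‖v‖) := by gcongr; exact Q.op.le_opNorm v
      _ = ‖Q.op‖ * ‖v‖ ^ 2 := by ring
  rw [Real.norm_eq_abs]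
  apply abs_le_of_sq_le_sq _ (by positivity)
  calc v (Q.ranIncl x) ^ 2 ≤ ‖x‖ ^ 2 * v (Q.op v) := h1
    _ ≤ ‖x‖ ^ 2 * (‖Q.op‖ * ‖v‖ ^ 2) := by gcongr
    _ = (Real.sqrt ‖Q.op‖ * ‖x‖ * ‖v‖) ^ 2 := by
      rw [mul_pow, mul_pow, Real.sq_sqrt (norm_nonneg Q.op)]; ring

/-- The inclusion of the range of `Q` into `U`, which is continuous for the norm of `H_Q`. -/
def PosSymmOp.ranInclL : Q.Ran →L[ℝ] U :=
  Q.ranIncl.mkContinuous (Real.sqrt ‖Q.op‖) Q.norm_ranIncl_le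

/-- The inclusion mapping `i_Q : H_Q → U`: the continuous extension of the inclusion of the range
of `Q`. -/
def PosSymmOp.iQ [CompleteSpace U] : Q.H →L[ℝ] U :=
  Q.ranInclL.extend (UniformSpace.Completion.toComplL (𝕜 := ℝ) (E := Q.Ran))

lemma PosSymmOp.iQ_coe [CompleteSpace U] (x : Q.Ran) : Q.iQ (x : Q.H) = Q.ranIncl x :=
  Q.ranInclL.extend_eq (e := UniformSpace.Completion.toComplL (𝕜 := ℝ) (E := Q.Ran))
    UniformSpace.Completion.denseRange_coe
    (UniformSpace.Completion.isUniformInducing_coe _) x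

/-- The adjoint `i_Q^* : U* → H_Q`, with `[h, i_Q^* u*] = ⟨i_Q h, u*⟩` (the dual space of `H_Q` is
identified with `H_Q`). -/
def PosSymmOp.iQadj [CompleteSpace U] (u : StrongDual ℝ U) : Q.H :=
  (InnerProductSpace.toDual ℝ Q.H).symm (u.comp Q.iQ)

lemma PosSymmOp.inner_iQadj [CompleteSpace U] (h : Q.H) (u : StrongDual ℝ U) :
    inner ℝ h (Q.iQadj u) = u (Q.iQ h) := by
  rw [real_inner_comm, PosSymmOp.iQadj, InnerProductSpace.toDual_symm_apply]; rfl

end RKHS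

/-! ### Cylindrical random variables, strongly Gaussian distributions -/

section Gaussian

variable {Ω : Type*} [mΩ : MeasurableSpace Ω]

/-- A cylindrical random variable in `U`: a linear map `U* → L⁰(Ω)`, where `L⁰(Ω)` is the space of
real random variables modulo almost sure equality. -/
abbrev CylindricalRV (P : Measure Ω) (U : Type*) [NormedAddCommGroup U] [NormedSpace ℝ U] :=
  StrongDual ℝ U →ₗ[ℝ] (Ω →ₘ[P] ℝ)

variable {P : Measure Ω} {U : Type*} [NormedAddCommGroup U] [NormedSpace ℝ U]

/-- The cylindrical distribution `μ` of `X` is strongly Gaussian: its one-dimensional images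
`μ_{u*}`, the laws of `Xu*`, are Gaussian with mean zero, and its covariance operator is
`U`-valued, that is, for every `u*` the functional
`v* ↦ r(u*, v*) = ∫ ⟨u,u*⟩⟨u,v*⟩ μ(du) - ∫ ⟨u,u*⟩ μ(du) ∫ ⟨u,v*⟩ μ(du) = Cov(Xu*, Xv*)`
is the evaluation at an element of `U`. -/
structure IsStronglyGaussian (X : CylindricalRV P U) : Prop where
  gaussian : ∀ u : StrongDual ℝ U, HasGaussianLaw (X u : Ω → ℝ) P
  centered : ∀ u : StrongDual ℝ U, ∫ ω, X u ω ∂P = 0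
  cov_mem : ∀ u : StrongDual ℝ U, ∃ q : U, ∀ v : StrongDual ℝ U,
    v q = cov[(X u : Ω → ℝ), (X v : Ω → ℝ); P]

namespace IsStronglyGaussian

variable {X : CylindricalRV P U} (hX : IsStronglyGaussian X)

/-- The values of the covariance operator. -/
def covFun (u : StrongDual ℝ U) : U := Classical.choose (hX.cov_mem u)

lemma apply_covFun (u v : StrongDual ℝ U) :
    v (hX.covFun u) = cov[(X u : Ω → ℝ), (X v : Ω → ℝ); P] :=
  Classical.choose_spec (hX.cov_mem u) v

lemma covFun_symm (u v : StrongDual ℝ U) : v (hX.covFun u) = u (hX.covFun v) := by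
  rw [apply_covFun, apply_covFun, covariance_comm]

lemma covFun_add (u w : StrongDual ℝ U) :
    hX.covFun (u + w) = hX.covFun u + hX.covFun w := by
  rw [SeparatingDual.eq_iff_forall_dual_eq (R := ℝ)]
  intro v
  rw [map_add, hX.covFun_symm _ v, hX.covFun_symm u v, hX.covFun_symm w v]
  rfl

lemma covFun_smul (r : ℝ) (u : StrongDual ℝ U) :
    hX.covFun (r • u) = r • hX.covFun u := by
  rw [SeparatingDual.eq_iff_forall_dual_eq (R := ℝ)]
  intro v
  rw [map_smul, hX.covFun_symm _ v, hX.covFun_symm u v]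
  rfl

/-- The covariance operator `Q : U* → U`, with `⟨Qu*, v*⟩ = Cov(Xu*, Xv*)`. It is automatically
linear, symmetric and positive, and it is bounded by the closed graph theorem. -/
def covOp [CompleteSpace U] : PosSymmOp U where
  op := ContinuousLinearMap.ofSeqClosedGraph
    (g := { toFun := hX.covFun, map_add' := hX.covFun_add, map_smul' := hX.covFun_smul })
    (by
      intro s x y hs hy
      rw [SeparatingDual.eq_iff_forall_dual_eq (R := ℝ)]
      intro v
      have h1 : Tendsto (fun n => v (hX.covFun (s n))) atTop (𝓝 (v y)) :=
        (v.continuous.tendsto y).comp hy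
      have h2 : Tendsto (fun n => s n (hX.covFun v)) atTop (𝓝 (x (hX.covFun v))) :=
        ((ContinuousLinearMap.apply ℝ ℝ (hX.covFun v)).continuous.tendsto x).comp hs
      have h3 : (fun n => v (hX.covFun (s n))) = fun n => s n (hX.covFun v) :=
        funext fun n => hX.covFun_symm _ _
      rw [h3] at h1
      exact (tendsto_nhds_unique h1 h2).trans (hX.covFun_symm v x))
  symm u v := hX.covFun_symm u v
  nonneg u := by
    change 0 ≤ u (hX.covFun u)
    rw [apply_covFun, covariance_self (X u).aemeasurable]
    exact variance_nonneg _ _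

lemma apply_covOp [CompleteSpace U] (u v : StrongDual ℝ U) :
    v (hX.covOp.op u) = cov[(X u : Ω → ℝ), (X v : Ω → ℝ); P] :=
  hX.apply_covFun u v

end IsStronglyGaussian

end Gaussian

/-! ### Wiener processes and cylindrical Wiener processes -/

section Wiener

variable {Ω : Type*} [mΩ : MeasurableSpace Ω]

/-- `B` is an `ℝⁿ`-valued Wiener process with respect to the filtration `F`: it starts in `0`, is
adapted (up to null sets), its increments `B(t) - B(s)` are independent of `F_s`, and they are
normally distributed with expectation `0` and covariance matrix `(t - s) C`. No path regularity is
imposed: `B(t)` matters only as a class of random variables modulo almost sure equality. -/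
structure IsWienerProcess (F : Filtration ℝ≥0 mΩ) (P : Measure Ω) {n : ℕ}
    (B : ℝ≥0 → Ω → (Fin n → ℝ)) (C : Matrix (Fin n) (Fin n) ℝ) : Prop where
  posSemidef : C.PosSemidef
  zero : B 0 =ᵐ[P] 0
  adapted : ∀ t, AEStronglyMeasurable[F t] (B t) P
  indep : ∀ s t, s ≤ t →
    Indep (MeasurableSpace.comap (fun ω => B t ω - B s ω) inferInstance) (F s) P
  gaussian : ∀ s t, s ≤ t → HasGaussianLaw (fun ω => B t ω - B s ω) P
  mean : ∀ s t, s ≤ t → ∀ i, ∫ ω, (B t ω i - B s ω i) ∂P = 0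
  covariance : ∀ s t, s ≤ t → ∀ i j,
    cov[fun ω => B t ω i - B s ω i, fun ω => B t ω j - B s ω j; P] = ((t : ℝ) - s) * C i j

variable {P : Measure Ω} {U : Type*} [NormedAddCommGroup U] [NormedSpace ℝ U]

/-- A weakly cylindrical Wiener process: all processes `(W(t)u₁*, …, W(t)uₙ*)` are Wiener
processes in `ℝⁿ`; in particular `W` is adapted. -/
def IsWeaklyCylindricalWiener (F : Filtration ℝ≥0 mΩ) (W : ℝ≥0 → CylindricalRV P U) : Prop :=
  ∀ (n : ℕ) (u : Fin n → StrongDual ℝ U), ∃ C : Matrix (Fin n) (Fin n) ℝ,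
    IsWienerProcess F P (fun t ω i => W t (u i) ω) C

/-- A strongly cylindrical Wiener process: a weakly cylindrical one for which the cylindrical
distribution of `W(1)` is strongly Gaussian. -/
structure IsStronglyCylindricalWiener (F : Filtration ℝ≥0 mΩ) (W : ℝ≥0 → CylindricalRV P U) :
    Prop where
  weak : IsWeaklyCylindricalWiener F W
  strong : IsStronglyGaussian (W 1)

/-- The covariance operator `Q` of a strongly cylindrical Wiener process, i.e. of `W(1)`. -/
def IsStronglyCylindricalWiener.Q [CompleteSpace U] {F : Filtration ℝ≥0 mΩ}
    {W : ℝ≥0 → CylindricalRV P U} (hW : IsStronglyCylindricalWiener F W) : PosSymmOp U :=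
  hW.strong.covOp

end Wiener

/-! ### The real-valued Itô integral -/

section Ito

variable {Ω : Type*} [mΩ : MeasurableSpace Ω]

/-- A simple process `∑_{i<n} ξ_i 1_{(t_i, t_{i+1}]}` with `t_0 ≤ t_1 ≤ …` and bounded
`F_{t_i}`-measurable random variables `ξ_i`. -/
structure SimpleProcess (F : Filtration ℝ≥0 mΩ) where
  n : ℕ
  time : ℕ → ℝ≥0
  mono : Monotone time
  coeff : ℕ → Ω → ℝ
  measurable : ∀ i, Measurable[F (time i)] (coeff i)
  bounded : ∀ i, ∃ c : ℝ, ∀ ω, |coeff i ω| ≤ c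

variable {F : Filtration ℝ≥0 mΩ}

/-- The value of a simple process at time `s`. -/
def SimpleProcess.val (S : SimpleProcess F) (s : ℝ≥0) (ω : Ω) : ℝ :=
  ∑ i ∈ Finset.range S.n, (Set.Ioc (S.time i) (S.time (i + 1))).indicator (fun _ => S.coeff i ω) s

/-- The elementary integral `∫_0^t S dB = ∑_i ξ_i (B(t_{i+1} ∧ t) - B(t_i ∧ t))`. -/
def SimpleProcess.integral (S : SimpleProcess F) (B : ℝ≥0 → Ω → ℝ) (t : ℝ≥0) (ω : Ω) : ℝ :=
  ∑ i ∈ Finset.range S.n, S.coeff i ω * (B (min (S.time (i + 1)) t) ω - B (min (S.time i) t) ω)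

/-- Lebesgue measure on `[0, t]`, as a measure on `ℝ≥0`. -/
def lebesgueIcc (t : ℝ≥0) : Measure ℝ≥0 :=
  (volume.restrict (Set.Icc (0 : ℝ) t)).map Real.toNNReal

/-- `Y ∈ L²(Ω)` is the Itô integral `∫_0^t f dB`: there are simple processes which converge to `f`
in `L²([0,t] × Ω)` and whose elementary integrals converge to `Y` in `L²(Ω)`. -/
def IsItoIntegral (F : Filtration ℝ≥0 mΩ) (P : Measure Ω) (B : ℝ≥0 → Ω → ℝ) (t : ℝ≥0)
    (f : ℝ≥0 → Ω → ℝ) (Y : Lp ℝ 2 P) : Prop :=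
  ∃ S : ℕ → SimpleProcess F,
    Tendsto (fun n => eLpNorm (fun p : ℝ≥0 × Ω => (S n).val p.1 p.2 - f p.1 p.2) 2
      ((lebesgueIcc t).prod P)) atTop (𝓝 0) ∧
    Tendsto (fun n => eLpNorm (fun ω => (S n).integral B t ω - Y ω) 2 P) atTop (𝓝 0)

open Classical in
/-- The Itô integral `∫_0^t f dB` as an element of `L²(Ω)` (and `0` if it does not exist). -/
def itoIntegral (F : Filtration ℝ≥0 mΩ) (P : Measure Ω) (B : ℝ≥0 → Ω → ℝ) (t : ℝ≥0)
    (f : ℝ≥0 → Ω → ℝ) : Lp ℝ 2 P :=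
  if h : ∃ Y, IsItoIntegral F P B t f Y then Classical.choose h else 0

end Ito

/-! ### The cylindrical stochastic integral -/

section Integral

variable {Ω : Type*} [mΩ : MeasurableSpace Ω] {P : Measure Ω}
  {U : Type*} [NormedAddCommGroup U] [NormedSpace ℝ U] [CompleteSpace U]
  {V : Type*} [NormedAddCommGroup V] [NormedSpace ℝ V]

/-- The class `M_T(U,V)` of integrands `Φ : [0,T] × Ω → L(U,V)`; the values `Φ s` for `s > T` play
no role. The dual operator is `Φ^*(s,ω)v* = v* ∘ Φ(s,ω)`, and `U*` carries the Borel σ-algebra of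
its norm. -/
structure MT (F : Filtration ℝ≥0 mΩ) (P : Measure Ω) (T : ℝ≥0) (Φ : ℝ≥0 → Ω → (U →L[ℝ] V)) :
    Prop where
  measurable : ∀ v : StrongDual ℝ V,
    Measurable (fun p : Set.Icc (0 : ℝ≥0) T × Ω => (v.comp (Φ p.1 p.2) : StrongDual ℝ U))
  adapted : ∀ v : StrongDual ℝ V, ∀ t ≤ T,
    Measurable[F t] (fun ω => (v.comp (Φ t ω) : StrongDual ℝ U))
  square_integrable : ∀ v : StrongDual ℝ V,
    ∫⁻ s, ∫⁻ ω, ‖(v.comp (Φ s ω) : StrongDual ℝ U)‖ₑ ^ 2 ∂P ∂(lebesgueIcc T) < ∞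

/-- The data of a series representation `W(t)u* = ∑_k ⟨i_Q e_k, u*⟩ B_k(t)`, `B_k(t) = W(t)u_k*`:
an orthonormal basis `(e_k)` of `H_Q` with a countable (finite or infinite) index set, and
functionals `u_k* ∈ U*` with `i_Q^* u_k* = e_k`. -/
structure SeriesRep (Q : PosSymmOp U) where
  ι : Type
  countable : Countable ι
  e : HilbertBasis ι ℝ Q.H
  u : ι → StrongDual ℝ U
  iQadj_u : ∀ k, Q.iQadj (u k) = e k

variable {F : Filtration ℝ≥0 mΩ} {W : ℝ≥0 → CylindricalRV P U}

/-- The real Wiener processes `B_k(t) = W(t)u_k*`. -/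
def SeriesRep.B {Q : PosSymmOp U} (R : SeriesRep Q) (W : ℝ≥0 → CylindricalRV P U)
    (k : R.ι) (t : ℝ≥0) : Ω → ℝ :=
  W t (R.u k)

/-- The integrands `⟨Φ(s) i_Q e_k, v*⟩`. -/
def SeriesRep.integrand {Q : PosSymmOp U} (R : SeriesRep Q)
    (Φ : ℝ≥0 → Ω → (U →L[ℝ] V)) (v : StrongDual ℝ V) (k : R.ι) (s : ℝ≥0) (ω : Ω) : ℝ :=
  v (Φ s ω (Q.iQ (R.e k)))

/-- The terms `∫_0^t ⟨Φ(s) i_Q e_k, v*⟩ dB_k(s)` of the series. -/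
def SeriesRep.term {Q : PosSymmOp U} (R : SeriesRep Q) (F : Filtration ℝ≥0 mΩ)
    (W : ℝ≥0 → CylindricalRV P U) (Φ : ℝ≥0 → Ω → (U →L[ℝ] V)) (t : ℝ≥0) (v : StrongDual ℝ V)
    (k : R.ι) : Lp ℝ 2 P :=
  itoIntegral F P (R.B W k) t (R.integrand Φ v k)

/-- `I_t(Φ)v* = ∑_k ∫_0^t ⟨Φ(s) i_Q e_k, v*⟩ dB_k(s)`, the sum being taken in `L²(Ω)`. -/
def SeriesRep.I {Q : PosSymmOp U} (R : SeriesRep Q) (F : Filtration ℝ≥0 mΩ)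
    (W : ℝ≥0 → CylindricalRV P U) (Φ : ℝ≥0 → Ω → (U →L[ℝ] V)) (t : ℝ≥0) (v : StrongDual ℝ V) :
    Lp ℝ 2 P :=
  ∑' k, R.term F W Φ t v k

end Integral

end CylindricalWiener

end

open CylindricalWiener

noncomputable section

namespace CylindricalWiener

/-! ### Increments of a Wiener process -/

section WienerIncrements

variable {Ω : Type*} [mΩ : MeasurableSpace Ω] {P : Measure Ω}
  {F : Filtration ℝ≥0 mΩ} {n : ℕ} {B : ℝ≥0 → Ω → (Fin n → ℝ)} {C : Matrix (Fin n) (Fin n) ℝ}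

/-! Everything rests on a joint Itô isometry: if `Y = ∫ f dW(·)u` and `Z = ∫ g dW(·)u'` on `[0,t]`,
then `E[YZ] = ⟨Qu,u'⟩ ⟨f,g⟩` with the inner product of `L²([0,t] × Ω)`. For simple processes
(`SimpleProcess.integral_mul_integral`) it follows from the independence of increments, and it
passes to `L²` limits (`inner_eq`). With `u = u'` it gives uniqueness of the real Itô integral, and
existence too, because simple processes are dense among the adapted square integrable ones
(`exists_simpleProcess_eLpNorm_le`).

Since `Q = i_Q i_Q^*`, the factor is `⟨Qu_k,u_l⟩ = [e_k,e_l]`. The terms of the series are therefore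
pairwise orthogonal, and their squared norms are those of `⟨Φ i_Q e_k, v*⟩`. Bessel's inequality
bounds the sum of these by the integral of `‖i_Q‖² ‖Φ^*v*‖²`, so the series converges
unconditionally.

For independence of the representation, put `φ(y) = ⟨Φ(·)y, v*⟩`. Expanding `i_Q^* w` in the basis
gives `⟨I_t(Φ)v*, ∫ g dW(·)w⟩ = ⟨φ(Qw), g⟩`, where neither `e_k` nor `u_k` occurs. As `I_t(Φ)v*`
lies in the closed span of the real Itô integrals, these inner products determine it
(`IsCylindricalIntegral.unique`). The characterization is linear in the pair of `φ` and the
integral, which also yields linearity in `v*`. -/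

lemma IsWienerProcess.aestronglyMeasurable_coord (h : IsWienerProcess F P B C) {s t : ℝ≥0}
    (hst : s ≤ t) (i : Fin n) : AEStronglyMeasurable[F t] (fun ω => B s ω i) P :=
  ((continuous_apply i).comp_aestronglyMeasurable (h.adapted s)).mono (F.mono hst)

lemma IsWienerProcess.memLp_increment (h : IsWienerProcess F P B C) {s t : ℝ≥0} (hst : s ≤ t)
    (i : Fin n) : MemLp (fun ω => B t ω i - B s ω i) 2 P :=
  HasGaussianLaw.memLp_two ((h.gaussian s t hst).eval i)

lemma IsWienerProcess.ae_zero (h : IsWienerProcess F P B C) (i : Fin n) :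
    ∀ᵐ ω ∂P, B 0 ω i = 0 := by
  filter_upwards [h.zero] with ω hω
  simp [hω]

lemma IsWienerProcess.memLp (h : IsWienerProcess F P B C) (t : ℝ≥0) (i : Fin n) :
    MemLp (fun ω => B t ω i) 2 P := by
  refine (memLp_congr_ae ?_).1 (h.memLp_increment (zero_le (a := t)) i)
  filter_upwards [h.ae_zero i] with ω hω
  simp [hω]

lemma IsWienerProcess.indepFun_increment (h : IsWienerProcess F P B C) {s t : ℝ≥0} (hst : s ≤ t)
    {η : Ω → ℝ} (hη : Measurable[F s] η) :
    IndepFun η (fun ω => B t ω - B s ω) P := by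
  rw [IndepFun_iff_Indep]
  exact indep_of_indep_of_le_left (h.indep s t hst).symm hη.comap_le

/-- Independence factors the expectation with no integrability assumption. Adaptedness holds only up
to null sets, so `η` is first replaced by an `F s`-measurable version. -/
lemma IsWienerProcess.integral_mul_comp_increment (h : IsWienerProcess F P B C) {s t : ℝ≥0}
    (hst : s ≤ t) {η : Ω → ℝ} (hη : AEStronglyMeasurable[F s] η P) {φ : (Fin n → ℝ) → ℝ}
    (hφ : Measurable φ) :
    ∫ ω, η ω * φ (B t ω - B s ω) ∂P = (∫ ω, η ω ∂P) * ∫ ω, φ (B t ω - B s ω) ∂P := by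
  obtain ⟨η', hη', he⟩ := hη
  rw [integral_congr_ae he, integral_congr_ae
    (show (fun ω => η ω * φ (B t ω - B s ω)) =ᵐ[P] fun ω => η' ω * φ (B t ω - B s ω) by
      filter_upwards [he] with ω hω
      rw [hω])]
  refine ((h.indepFun_increment hst hη'.measurable).comp measurable_id
    hφ).integral_fun_mul_eq_mul_integral ?_ ?_
  · exact (hη'.mono (F.le s)).aestronglyMeasurable
  · exact (hφ.comp_aemeasurable (h.gaussian s t hst).aemeasurable).aestronglyMeasurable

lemma IsWienerProcess.integral_mul_increment (h : IsWienerProcess F P B C) {s t : ℝ≥0}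
    (hst : s ≤ t) (i : Fin n) {η : Ω → ℝ} (hη : AEStronglyMeasurable[F s] η P) :
    ∫ ω, η ω * (B t ω i - B s ω i) ∂P = 0 := by
  refine (h.integral_mul_comp_increment hst hη (measurable_pi_apply i)).trans ?_
  simp only [Pi.sub_apply, h.mean s t hst i, mul_zero]

variable [IsProbabilityMeasure P]

lemma IsWienerProcess.integral_mul_increment_mul_increment (h : IsWienerProcess F P B C)
    {s t : ℝ≥0} (hst : s ≤ t) (i j : Fin n) {η : Ω → ℝ} (hη : AEStronglyMeasurable[F s] η P) :
    ∫ ω, η ω * ((B t ω i - B s ω i) * (B t ω j - B s ω j)) ∂P =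
      (∫ ω, η ω ∂P) * (((t : ℝ) - s) * C i j) := by
  refine (h.integral_mul_comp_increment hst hη
    ((measurable_pi_apply i).mul (measurable_pi_apply j))).trans ?_
  rw [← h.covariance s t hst i j, covariance_eq_sub (h.memLp_increment hst i)
    (h.memLp_increment hst j), h.mean s t hst i]
  simp

/-- A product of a bounded and two square integrable random variables is integrable. -/
lemma integrable_bdd_mul_mul {α : Type*} [MeasurableSpace α] {μ : Measure α} {ζ X Y : α → ℝ}
    {c : ℝ} (hζ : AEStronglyMeasurable ζ μ) (hc : ∀ ω, |ζ ω| ≤ c) (hX : MemLp X 2 μ)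
    (hY : MemLp Y 2 μ) : Integrable (fun ω => ζ ω * (X ω * Y ω)) μ :=
  (hX.integrable_mul hY).bdd_mul hζ (ae_of_all _ hc)

/-- Only the overlap `(a', min b b']` of the two time intervals contributes: on disjoint pieces the
later increment has mean zero and is independent of the weight times the earlier one. The truncated
subtraction covers the case of no overlap. -/
lemma IsWienerProcess.integral_mul_increments_of_le (h : IsWienerProcess F P B C)
    {a b a' b' : ℝ≥0} (hab : a ≤ b) (hab' : a' ≤ b') (haa' : a ≤ a') (i j : Fin n)
    {ζ : Ω → ℝ} {c : ℝ} (hζ : AEStronglyMeasurable[F a'] ζ P) (hc : ∀ ω, |ζ ω| ≤ c) :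
    ∫ ω, ζ ω * ((B b ω i - B a ω i) * (B b' ω j - B a' ω j)) ∂P =
      (∫ ω, ζ ω ∂P) * (((min b b' - a' : ℝ≥0) : ℝ) * C i j) := by
  have hI : ∀ {p q p' q' : ℝ≥0} (i j : Fin n), Integrable
      (fun ω => ζ ω * ((B q ω i - B p ω i) * (B q' ω j - B p' ω j))) P := fun i j =>
    integrable_bdd_mul_mul (hζ.mono (F.le a')) hc ((h.memLp _ _).sub (h.memLp _ _))
      ((h.memLp _ _).sub (h.memLp _ _))
  -- increments over consecutive intervals do not contribute
  have hzero : ∀ {p q p' q' : ℝ≥0} (i j : Fin n), p ≤ q → q ≤ p' → p' ≤ q' → a' ≤ p' →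
      ∫ ω, ζ ω * ((B q ω i - B p ω i) * (B q' ω j - B p' ω j)) ∂P = 0 := by
    intro p q p' q' i j h1 h2 h3 h4
    simp_rw [← mul_assoc]
    exact h.integral_mul_increment h3 j ((hζ.mono (F.mono h4)).mul
      ((h.aestronglyMeasurable_coord h2 i).sub (h.aestronglyMeasurable_coord (h1.trans h2) i)))
  rcases le_total b a' with hb | hb
  · rw [hzero i j hab hb hab' le_rfl, tsub_eq_zero_of_le ((min_le_left _ _).trans hb)]
    simp
  -- Discard the part `(a, a']` of the first interval, so that both increments start at `a'`; below,
  -- the longer one is cut at `min b b'`.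
  have hsplit : ∫ ω, ζ ω * ((B b ω i - B a ω i) * (B b' ω j - B a' ω j)) ∂P =
      ∫ ω, ζ ω * ((B b ω i - B a' ω i) * (B b' ω j - B a' ω j)) ∂P := by
    rw [← zero_add (∫ ω, ζ ω * ((B b ω i - B a' ω i) * (B b' ω j - B a' ω j)) ∂P),
      ← hzero i j haa' le_rfl hab' le_rfl, ← integral_add (hI i j) (hI i j)]
    refine integral_congr_ae (ae_of_all _ fun ω => ?_)
    ring
  rw [hsplit]
  rcases le_total b b' with hbb | hbb
  · rw [min_eq_left hbb, NNReal.coe_sub hb, ← h.integral_mul_increment_mul_increment hb i j hζ,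
      ← add_zero (∫ ω, ζ ω * ((B b ω i - B a' ω i) * (B b ω j - B a' ω j)) ∂P),
      ← hzero i j hb le_rfl hbb hb, ← integral_add (hI i j) (hI i j)]
    refine integral_congr_ae (ae_of_all _ fun ω => ?_)
    ring
  · rw [min_eq_right hbb, NNReal.coe_sub hab',
      ← h.integral_mul_increment_mul_increment hab' i j hζ,
      ← add_zero (∫ ω, ζ ω * ((B b' ω i - B a' ω i) * (B b' ω j - B a' ω j)) ∂P),
      ← hzero j i hab' le_rfl hbb hab', ← integral_add (hI i j) (hI j i)]
    refine integral_congr_ae (ae_of_all _ fun ω => ?_)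
    ring

lemma IsWienerProcess.integral_mul_increments (h : IsWienerProcess F P B C)
    {a b a' b' : ℝ≥0} (hab : a ≤ b) (hab' : a' ≤ b') (i j : Fin n)
    {ζ : Ω → ℝ} {c : ℝ} (hζ : AEStronglyMeasurable[F (max a a')] ζ P) (hc : ∀ ω, |ζ ω| ≤ c) :
    ∫ ω, ζ ω * ((B b ω i - B a ω i) * (B b' ω j - B a' ω j)) ∂P =
      (∫ ω, ζ ω ∂P) * (((min b b' - max a a' : ℝ≥0) : ℝ) * C i j) := by
  rcases le_total a a' with haa | haa
  · rw [max_eq_right haa] at hζ ⊢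
    exact h.integral_mul_increments_of_le hab hab' haa i j hζ hc
  · rw [max_eq_left haa] at hζ ⊢
    have hC : C i j = C j i := by simpa using h.posSemidef.isHermitian.apply j i
    rw [hC, min_comm, ← h.integral_mul_increments_of_le hab' hab haa j i hζ hc]
    simp_rw [mul_comm (B b _ i - B a _ i)]

end WienerIncrements

/-! ### The isometry for simple processes -/

section SimpleProcesses

variable {Ω : Type*} [mΩ : MeasurableSpace Ω] {P : Measure Ω} {F : Filtration ℝ≥0 mΩ}

lemma lebesgueIcc_apply {t : ℝ≥0} {s : Set ℝ≥0} (hs : MeasurableSet s) :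
    lebesgueIcc t s = volume (Real.toNNReal ⁻¹' s ∩ Set.Icc (0 : ℝ) t) := by
  rw [lebesgueIcc, Measure.map_apply measurable_real_toNNReal hs,
    Measure.restrict_apply (measurable_real_toNNReal hs)]

instance (t : ℝ≥0) : IsFiniteMeasure (lebesgueIcc t) := by
  rw [lebesgueIcc]
  infer_instance

lemma lebesgueIcc_Ioc (t a b : ℝ≥0) :
    (lebesgueIcc t).real (Set.Ioc a b) = ((min b t - min a t : ℝ≥0) : ℝ) := by
  have : Real.toNNReal ⁻¹' Set.Ioc a b ∩ Set.Icc (0 : ℝ) t =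
      Set.Ioc (a : ℝ) (min b t : ℝ≥0) := by
    ext x
    simp only [Set.mem_inter_iff, Set.mem_preimage, Set.mem_Ioc, Set.mem_Icc, NNReal.coe_min,
      le_min_iff, Real.lt_toNNReal_iff_coe_lt, Real.toNNReal_le_iff_le_coe]
    constructor
    · rintro ⟨⟨h1, h2⟩, h3, h4⟩
      exact ⟨h1, h2, h4⟩
    · rintro ⟨h1, h2, h4⟩
      exact ⟨⟨h1, h2⟩, a.2.trans h1.le, h4⟩
  rw [Measure.real, lebesgueIcc_apply measurableSet_Ioc, this, Real.volume_Ioc,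
    ENNReal.toReal_ofReal', NNReal.coe_sub_def]
  rcases le_total a t with h | h
  · rw [min_eq_left h]
  · have h1 : ((min b t : ℝ≥0) : ℝ) ≤ t := NNReal.coe_le_coe.2 (min_le_right _ _)
    have h2 : (t : ℝ) ≤ a := NNReal.coe_le_coe.2 h
    rw [min_eq_right h, max_eq_right (by linarith), max_eq_right (by linarith)]

lemma SimpleProcess.measurable_coeff (S : SimpleProcess F) (i : ℕ) : Measurable (S.coeff i) :=
  (S.measurable i).mono (F.le _) le_rfl

lemma SimpleProcess.measurable_term (S : SimpleProcess F) (i : ℕ) :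
    Measurable (fun p : ℝ≥0 × Ω => (Set.Ioc (S.time i) (S.time (i + 1))).indicator
      (fun _ => S.coeff i p.2) p.1) := by
  have : (fun p : ℝ≥0 × Ω => (Set.Ioc (S.time i) (S.time (i + 1))).indicator
      (fun _ => S.coeff i p.2) p.1) =
      (Set.Ioc (S.time i) (S.time (i + 1)) ×ˢ Set.univ).indicator (fun p => S.coeff i p.2) := by
    ext p
    simp [Set.indicator]
  rw [this]
  exact ((S.measurable_coeff i).comp measurable_snd).indicator
    (measurableSet_Ioc.prod MeasurableSet.univ)

lemma SimpleProcess.measurable_val (S : SimpleProcess F) :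
    Measurable (fun p : ℝ≥0 × Ω => S.val p.1 p.2) :=
  Finset.measurable_fun_sum _ fun i _ => S.measurable_term i

lemma SimpleProcess.memLp_val [IsFiniteMeasure P] (S : SimpleProcess F) (t : ℝ≥0) :
    MemLp (fun p : ℝ≥0 × Ω => S.val p.1 p.2) 2 ((lebesgueIcc t).prod P) := by
  refine memLp_finsetSum _ fun i _ => ?_
  obtain ⟨c, hc⟩ := S.bounded i
  refine MemLp.of_bound (S.measurable_term i).aestronglyMeasurable c (ae_of_all _ fun p => ?_)
  refine (norm_indicator_le_norm_self _ _).trans ?_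
  exact hc _

lemma SimpleProcess.memLp_integral [IsProbabilityMeasure P] {n : ℕ} {B : ℝ≥0 → Ω → (Fin n → ℝ)}
    {C : Matrix (Fin n) (Fin n) ℝ} (h : IsWienerProcess F P B C) (S : SimpleProcess F) (t : ℝ≥0)
    (j : Fin n) : MemLp (S.integral (fun s ω => B s ω j) t) 2 P := by
  refine memLp_finsetSum _ fun i _ => ?_
  obtain ⟨c, hc⟩ := S.bounded i
  refine ((h.memLp _ j).sub (h.memLp _ j)).mul (MemLp.of_bound (p := ∞)
    (S.measurable_coeff i).aestronglyMeasurable c (ae_of_all _ hc))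

/-- The isometry of the elementary integrals with respect to two components of a Wiener process. -/
lemma SimpleProcess.integral_mul_integral [IsProbabilityMeasure P] {n : ℕ}
    {B : ℝ≥0 → Ω → (Fin n → ℝ)} {C : Matrix (Fin n) (Fin n) ℝ} (h : IsWienerProcess F P B C)
    (S S' : SimpleProcess F) (t : ℝ≥0) (i j : Fin n) :
    ∫ ω, S.integral (fun s ω => B s ω i) t ω * S'.integral (fun s ω => B s ω j) t ω ∂P =
      C i j * ∫ p : ℝ≥0 × Ω, S.val p.1 p.2 * S'.val p.1 p.2 ∂((lebesgueIcc t).prod P) := by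
  have hb : ∀ k l, ∃ c : ℝ, ∀ ω, |S.coeff k ω * S'.coeff l ω| ≤ c := by
    intro k l
    obtain ⟨c, hc⟩ := S.bounded k
    obtain ⟨c', hc'⟩ := S'.bounded l
    refine ⟨c * c', fun ω => ?_⟩
    rw [abs_mul]
    exact mul_le_mul (hc ω) (hc' ω) (abs_nonneg _) ((abs_nonneg _).trans (hc ω))
  have hm : ∀ k l, Measurable fun ω => S.coeff k ω * S'.coeff l ω := fun k l =>
    (S.measurable_coeff k).mul (S'.measurable_coeff l)
  have hI : ∀ k l, Integrable (fun p : ℝ≥0 × Ω =>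
      (Set.Ioc (S.time k) (S.time (k + 1)) ∩ Set.Ioc (S'.time l) (S'.time (l + 1))).indicator
        (fun _ => (1 : ℝ)) p.1 * (S.coeff k p.2 * S'.coeff l p.2)) ((lebesgueIcc t).prod P) := by
    intro k l
    obtain ⟨c, hc⟩ := hb k l
    exact Integrable.mul_prod (f := (Set.Ioc (S.time k) (S.time (k + 1)) ∩
        Set.Ioc (S'.time l) (S'.time (l + 1))).indicator (fun _ => (1 : ℝ)))
      (g := fun ω => S.coeff k ω * S'.coeff l ω)
      ((integrable_const (1 : ℝ)).indicator (measurableSet_Ioc.inter measurableSet_Ioc))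
      (Integrable.of_bound (hm k l).aestronglyMeasurable c (ae_of_all _ hc))
  have e1 : ∀ ω, S.integral (fun s ω => B s ω i) t ω * S'.integral (fun s ω => B s ω j) t ω =
      ∑ k ∈ Finset.range S.n, ∑ l ∈ Finset.range S'.n, (S.coeff k ω * S'.coeff l ω) *
        ((B (min (S.time (k + 1)) t) ω i - B (min (S.time k) t) ω i) *
        (B (min (S'.time (l + 1)) t) ω j - B (min (S'.time l) t) ω j)) := by
    intro ω
    simp only [SimpleProcess.integral, Finset.sum_mul_sum]
    refine Finset.sum_congr rfl fun k _ => Finset.sum_congr rfl fun l _ => ?_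
    ring
  -- Each summand is a function of time times a function of `ω`, so its integral over the product
  -- measure factors.
  have e2 : ∀ p : ℝ≥0 × Ω, S.val p.1 p.2 * S'.val p.1 p.2 =
      ∑ k ∈ Finset.range S.n, ∑ l ∈ Finset.range S'.n,
        (Set.Ioc (S.time k) (S.time (k + 1)) ∩ Set.Ioc (S'.time l) (S'.time (l + 1))).indicator
          (fun _ => (1 : ℝ)) p.1 * (S.coeff k p.2 * S'.coeff l p.2) := by
    intro p
    simp only [SimpleProcess.val, Finset.sum_mul_sum]
    refine Finset.sum_congr rfl fun k _ => Finset.sum_congr rfl fun l _ => ?_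
    by_cases h1 : p.1 ∈ Set.Ioc (S.time k) (S.time (k + 1)) <;>
      by_cases h2 : p.1 ∈ Set.Ioc (S'.time l) (S'.time (l + 1)) <;>
      simp only [Set.indicator, Set.mem_inter_iff, h1, h2] <;> simp
  simp_rw [e1, e2]
  rw [integral_finsetSum, integral_finsetSum, Finset.mul_sum]
  rotate_left
  · intro k _
    refine integrable_finsetSum _ fun l _ => ?_
    exact hI k l
  · intro k _
    refine integrable_finsetSum _ fun l _ => ?_
    obtain ⟨c, hc⟩ := hb k l
    exact integrable_bdd_mul_mul (hm k l).aestronglyMeasurable hc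
      ((h.memLp _ _).sub (h.memLp _ _)) ((h.memLp _ _).sub (h.memLp _ _))
  refine Finset.sum_congr rfl fun k _ => ?_
  rw [integral_finsetSum, integral_finsetSum, Finset.mul_sum]
  rotate_left
  · intro l _
    exact hI k l
  · intro l _
    obtain ⟨c, hc⟩ := hb k l
    exact integrable_bdd_mul_mul (hm k l).aestronglyMeasurable hc
      ((h.memLp _ _).sub (h.memLp _ _)) ((h.memLp _ _).sub (h.memLp _ _))
  refine Finset.sum_congr rfl fun l _ => ?_
  obtain ⟨c, hc⟩ := hb k l
  rw [integral_prod_mul (fun s => (Set.Ioc (S.time k) (S.time (k + 1)) ∩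
    Set.Ioc (S'.time l) (S'.time (l + 1))).indicator (fun _ => (1 : ℝ)) s)
    (fun ω => S.coeff k ω * S'.coeff l ω), integral_indicator_const _
    (measurableSet_Ioc.inter measurableSet_Ioc), smul_eq_mul, mul_one, Set.Ioc_inter_Ioc,
    lebesgueIcc_Ioc]
  have hk := S.mono (Nat.le_succ k)
  have hl := S'.mono (Nat.le_succ l)
  -- If `t` precedes the later left endpoint, one stopped increment vanishes and so does the time
  -- overlap. Otherwise stopping at `t` leaves both left endpoints unchanged, and the product of
  -- coefficients is measurable at the later one.
  rcases lt_or_ge t (max (S.time k) (S'.time l)) with ht | ht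
  · have hz : min (min (S.time (k + 1)) (S'.time (l + 1))) t -
        min (max (S.time k) (S'.time l)) t = 0 := by
      rw [min_eq_right ht.le]
      exact tsub_eq_zero_of_le (min_le_right _ _)
    change _ = C i j * (((min (min (S.time (k + 1)) (S'.time (l + 1))) t -
        min (max (S.time k) (S'.time l)) t : ℝ≥0) : ℝ) * _)
    rw [hz]
    rcases lt_max_iff.1 ht with h1 | h1
    · have h2 : min (S.time (k + 1)) t = min (S.time k) t := by
        rw [min_eq_right h1.le, min_eq_right (h1.le.trans hk)]
      simp [h2]
    · have h2 : min (S'.time (l + 1)) t = min (S'.time l) t := by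
        rw [min_eq_right h1.le, min_eq_right (h1.le.trans hl)]
      simp [h2]
  · have h1 : min (S.time k) t = S.time k := min_eq_left ((le_max_left _ _).trans ht)
    have h2 : min (S'.time l) t = S'.time l := min_eq_left ((le_max_right _ _).trans ht)
    rw [h.integral_mul_increments (min_le_min_right t hk) (min_le_min_right t hl) i j (c := c)
      ?_ hc]
    · rw [h1, h2, min_eq_left ht, ← inf_inf_distrib_right]
      simp only [Nat.succ_eq_add_one]
      ring
    · rw [h1, h2]
      exact (((S.measurable k).mono (F.mono (le_max_left _ _)) le_rfl).mul
        ((S'.measurable l).mono (F.mono (le_max_right _ _)) le_rfl)).aestronglyMeasurable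

end SimpleProcesses

/-! ### Density of the simple processes -/

section Density

lemma eLpNorm_two_sq {α : Type*} [MeasurableSpace α] (μ : Measure α) (f : α → ℝ) :
    eLpNorm f 2 μ ^ 2 = ∫⁻ x, ‖f x‖ₑ ^ 2 ∂μ := by
  have := eLpNorm_nnreal_pow_eq_lintegral (f := f) (μ := μ) (p := 2) two_ne_zero
  simpa only [NNReal.coe_ofNat, ENNReal.rpow_two, ENNReal.coe_ofNat] using this

/-- Translations are continuous in `L²(ℝ)`. -/
lemma tendsto_lintegral_sub_translate {h : ℝ → ℝ} (hh : MemLp h 2 volume) :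
    Tendsto (fun r : ℝ => ∫⁻ x, ‖h x - h (x + r)‖ₑ ^ 2) (𝓝 0) (𝓝 0) := by
  have hmp : ∀ r : ℝ, MeasurePreserving (fun x : ℝ => x + r) volume volume :=
    fun r => measurePreserving_add_right volume r
  let g : ℝ → C(ℝ, ℝ) := fun r => ⟨fun x => x + r, by fun_prop⟩
  have hg : Continuous g := ContinuousMap.continuous_of_continuous_uncurry _
    (show Continuous fun p : ℝ × ℝ => p.2 + p.1 by fun_prop)
  have h1 : Tendsto (fun r => Lp.compMeasurePreserving (g r) (hmp r) (hh.toLp h)) (𝓝 0)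
      (𝓝 (Lp.compMeasurePreserving (g 0) (hmp 0) (hh.toLp h))) :=
    Filter.Tendsto.compMeasurePreservingLp tendsto_const_nhds (hg.tendsto 0) hmp (hmp 0)
      (by simp)
  simp only [Lp.toLp_compMeasurePreserving] at h1
  rw [Lp.tendsto_Lp_iff_tendsto_eLpNorm''] at h1
  have h2 := (ENNReal.continuous_pow 2).tendsto 0 |>.comp h1
  simp only [Function.comp_def, eLpNorm_two_sq] at h2
  refine (h2.congr fun r => ?_).trans (by simp)
  refine lintegral_congr fun x => ?_
  simp only [g, ContinuousMap.coe_mk, Pi.sub_apply, add_zero]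
  rw [← enorm_neg, neg_sub]

lemma sum_setLIntegral_Ioc {a : ℕ → ℝ} (ha : Monotone a) (φ : ℝ → ℝ≥0∞) (N : ℕ) :
    ∑ k ∈ Finset.range N, ∫⁻ x in Set.Ioc (a k) (a (k + 1)), φ x =
      ∫⁻ x in Set.Ioc (a 0) (a N), φ x := by
  induction N with
  | zero => simp
  | succ N ih =>
    rw [Finset.sum_range_succ, ih, ← lintegral_union measurableSet_Ioc,
      Set.Ioc_union_Ioc_eq_Ioc (ha (Nat.zero_le N)) (ha (Nat.le_succ N))]
    exact Set.Ioc_disjoint_Ioc_of_le le_rfl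

lemma setLIntegral_Ioc_translate (a b δ : ℝ) (φ : ℝ → ℝ≥0∞) :
    ∫⁻ x in Set.Ioc (a + b) (a + b + δ), φ x = ∫⁻ r in Set.Ioc b (b + δ), φ (a + r) := by
  rw [← lintegral_indicator measurableSet_Ioc, ← lintegral_indicator measurableSet_Ioc,
    ← lintegral_add_left_eq_self _ a]
  refine lintegral_congr fun x => ?_
  simp [Set.indicator, add_assoc]

/-- Averaging over the position of a grid. -/
lemma exists_shift_le {K : ℝ → ℝ → ℝ≥0∞} (hK : Measurable (Function.uncurry K)) {δ : ℝ}
    (hδ : 0 < δ) {η : ℝ≥0∞} (hη : ∀ r ∈ Set.Ioc 0 δ, ∫⁻ x, K x (x + r) ≤ η) (N : ℕ) :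
    ∃ u ∈ Set.Ioc 0 δ, ∑ k ∈ Finset.range N,
      ∫⁻ x in Set.Ioc (u + k * δ) (u + (k + 1 : ℕ) * δ), K (u + k * δ) x ≤ η := by
  have hmeas : ∀ k : ℕ, Measurable fun p : ℝ × ℝ => K (p.1 + k * δ) (p.1 + k * δ + p.2) :=
    fun k => hK.comp (f := fun p : ℝ × ℝ => (p.1 + k * δ, p.1 + k * δ + p.2)) (by fun_prop)
  have e1 : ∀ (u : ℝ) (k : ℕ),
      ∫⁻ x in Set.Ioc (u + k * δ) (u + (k + 1 : ℕ) * δ), K (u + k * δ) x =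
        ∫⁻ r in Set.Ioc 0 δ, K (u + k * δ) (u + k * δ + r) := by
    intro u k
    have := setLIntegral_Ioc_translate (u + k * δ) 0 δ (K (u + k * δ))
    rw [add_zero, zero_add] at this
    rw [← this]
    congr 3
    push_cast
    ring
  simp_rw [e1]
  have hmeas' : ∀ k : ℕ, Measurable fun u : ℝ =>
      ∫⁻ r in Set.Ioc 0 δ, K (u + k * δ) (u + k * δ + r) := fun k =>
    (hmeas k).lintegral_prod_right'
  have hvol0 : volume (Set.Ioc 0 δ) ≠ 0 := by simpa using hδ
  -- Some offset `u` does no worse than the average over `(0, δ]`, so it suffices to bound this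
  -- average by `η`.
  obtain ⟨u, hu, hle⟩ := exists_le_setLAverage (μ := volume) (s := Set.Ioc 0 δ) hvol0
    (by simp) (f := fun u => ∑ k ∈ Finset.range N,
      ∫⁻ r in Set.Ioc 0 δ, K (u + k * δ) (u + k * δ + r))
    (Finset.measurable_fun_sum _ fun k _ => hmeas' k).aemeasurable
  refine ⟨u, hu, hle.trans ?_⟩
  rw [setLAverage_eq, ENNReal.div_le_iff_le_mul (Or.inl hvol0) (Or.inl (by simp)),
    lintegral_finsetSum _ fun k _ => hmeas' k]
  -- For a fixed lag `r`, the point `u + kδ` sweeps the cell `(kδ, (k+1)δ]` as `u` varies; summing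
  -- over `k` leaves one integral of `K x (x + r)` over `(0, Nδ]`.
  have e2 : ∀ k : ℕ, ∫⁻ u in Set.Ioc 0 δ, ∫⁻ r in Set.Ioc 0 δ, K (u + k * δ) (u + k * δ + r) =
      ∫⁻ r in Set.Ioc 0 δ, ∫⁻ x in Set.Ioc (k * δ) ((k + 1 : ℕ) * δ), K x (x + r) := by
    intro k
    rw [lintegral_lintegral_swap (hmeas k).aemeasurable]
    refine lintegral_congr fun r => ?_
    have := setLIntegral_Ioc_translate (k * δ) 0 δ (fun x => K x (x + r))
    rw [add_zero, zero_add] at this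
    rw [show ((k + 1 : ℕ) : ℝ) * δ = k * δ + δ by push_cast; ring, this]
    simp_rw [add_comm]
  simp_rw [e2]
  have hmeas2 : Measurable fun p : ℝ × ℝ => K p.2 (p.2 + p.1) :=
    hK.comp (f := fun p : ℝ × ℝ => (p.2, p.2 + p.1)) (by fun_prop)
  rw [← lintegral_finsetSum _ fun k _ => hmeas2.lintegral_prod_right']
  have hmono : Monotone fun k : ℕ => (k : ℝ) * δ := fun k l hkl =>
    mul_le_mul_of_nonneg_right (Nat.cast_le.2 hkl) hδ.le
  calc ∫⁻ r in Set.Ioc 0 δ, ∑ k ∈ Finset.range N,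
        ∫⁻ x in Set.Ioc (k * δ) ((k + 1 : ℕ) * δ), K x (x + r)
      ≤ ∫⁻ r in Set.Ioc 0 δ, η := by
        refine setLIntegral_mono measurable_const fun r hr => ?_
        rw [sum_setLIntegral_Ioc hmono (fun x => K x (x + r))]
        exact (setLIntegral_le_lintegral _ _).trans (hη r hr)
    _ = η * volume (Set.Ioc 0 δ) := by simp

variable {Ω : Type*} [mΩ : MeasurableSpace Ω] {P : Measure Ω} {F : Filtration ℝ≥0 mΩ}

/-- The simple process which samples `f` at the times `u + k * δ`. -/
def SimpleProcess.sample (f : ℝ≥0 → Ω → ℝ) (ha : ∀ s, Measurable[F s] (f s)) {c : ℝ}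
    (hc : ∀ s ω, |f s ω| ≤ c) (u δ : ℝ≥0) (N : ℕ) : SimpleProcess F where
  n := N
  time k := u + k * δ
  mono k l hkl := by
    change u + (k : ℝ≥0) * δ ≤ u + (l : ℝ≥0) * δ
    gcongr
  coeff k := f (u + k * δ)
  measurable k := ha _
  bounded k := ⟨c, hc _⟩

lemma SimpleProcess.val_eq_coeff (S : SimpleProcess F) {k : ℕ} (hk : k < S.n) {s : ℝ≥0}
    (hs : s ∈ Set.Ioc (S.time k) (S.time (k + 1))) (ω : Ω) : S.val s ω = S.coeff k ω := by
  rw [SimpleProcess.val, Finset.sum_eq_single k, Set.indicator_of_mem hs]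
  · intro l _ hlk
    refine Set.indicator_of_notMem (fun hl => ?_) _
    rcases lt_or_gt_of_ne hlk with h | h
    · exact absurd (hl.2.trans (S.mono h)) (not_le.2 hs.1)
    · exact absurd (hs.2.trans (S.mono h)) (not_le.2 hl.1)
  · intro h
    exact absurd (Finset.mem_range.2 hk) h

lemma SimpleProcess.val_eq_zero (S : SimpleProcess F) {s : ℝ≥0} (hs : s ≤ S.time 0) (ω : Ω) :
    S.val s ω = 0 := by
  refine Finset.sum_eq_zero fun l _ => Set.indicator_of_notMem (fun hl => ?_) _
  exact absurd (hs.trans (S.mono (Nat.zero_le l))) (not_le.2 hl.1)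

/-- The `L²` modulus of continuity of a bounded, compactly supported process. -/
lemma tendsto_lintegral_lintegral_sub_translate [IsProbabilityMeasure P] {g : ℝ → Ω → ℝ}
    (hg : Measurable (Function.uncurry g)) {c : ℝ} (hc : ∀ x ω, |g x ω| ≤ c) {t : ℝ}
    (hs : ∀ x ∉ Set.Icc 0 t, ∀ ω, g x ω = 0) :
    Tendsto (fun r : ℝ => ∫⁻ x, ∫⁻ ω, ‖g x ω - g (x + r) ω‖ₑ ^ 2 ∂P) (𝓝 0) (𝓝 0) := by
  have hm : ∀ r : ℝ, Measurable fun p : ℝ × Ω => ‖g p.1 p.2 - g (p.1 + r) p.2‖ₑ ^ 2 := by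
    intro r
    have h1 : Measurable fun p : ℝ × Ω => g (p.1 + r) p.2 :=
      hg.comp (f := fun p : ℝ × Ω => (p.1 + r, p.2)) (by fun_prop)
    exact ((hg.sub h1).enorm).pow_const 2
  have hswap : ∀ r : ℝ, ∫⁻ x, ∫⁻ ω, ‖g x ω - g (x + r) ω‖ₑ ^ 2 ∂P =
      ∫⁻ ω, (∫⁻ x, ‖g x ω - g (x + r) ω‖ₑ ^ 2) ∂P := fun r =>
    lintegral_lintegral_swap (f := fun x ω => ‖g x ω - g (x + r) ω‖ₑ ^ 2) (hm r).aemeasurable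
  -- With the time integral inside, continuity of translations applies for each `ω`, and dominated
  -- convergence handles the expectation. For `|r| < 1` the integrand is supported in `[-1, t + 1]`.
  simp_rw [hswap]
  have hlim : ∀ ω, Tendsto (fun r : ℝ => ∫⁻ x, ‖g x ω - g (x + r) ω‖ₑ ^ 2) (𝓝 0) (𝓝 0) := by
    intro ω
    refine tendsto_lintegral_sub_translate (h := fun x => g x ω) ?_
    have e : (fun x => g x ω) = (Set.Icc 0 t).indicator (fun x => g x ω) := by
      ext x
      by_cases hx : x ∈ Set.Icc 0 t
      · rw [Set.indicator_of_mem hx]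
      · rw [Set.indicator_of_notMem hx, hs x hx]
    rw [e, memLp_indicator_iff_restrict measurableSet_Icc]
    exact MemLp.of_bound (hg.of_uncurry_right).aestronglyMeasurable c (ae_of_all _ fun x => hc x ω)
  have hmain := tendsto_lintegral_filter_of_dominated_convergence (μ := P) (l := 𝓝 (0 : ℝ))
    (F := fun r ω => ∫⁻ x, ‖g x ω - g (x + r) ω‖ₑ ^ 2) (f := fun _ => 0)
    (fun _ => ∫⁻ x, (Set.Icc (-1) (t + 1)).indicator (fun _ => ENNReal.ofReal (2 * c) ^ 2) x)
    (Eventually.of_forall fun r => (hm r).lintegral_prod_left') ?_ ?_ (ae_of_all _ hlim)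
  · simpa using hmain
  · filter_upwards [Metric.ball_mem_nhds (0 : ℝ) one_pos] with r hr
    refine ae_of_all _ fun ω => lintegral_mono fun x => ?_
    rw [Real.ball_eq_Ioo] at hr
    by_cases hx : x ∈ Set.Icc (-1) (t + 1)
    · rw [Set.indicator_of_mem hx, Real.enorm_eq_ofReal_abs]
      gcongr
      calc |g x ω - g (x + r) ω| ≤ |g x ω| + |g (x + r) ω| := abs_sub _ _
        _ ≤ 2 * c := by linarith [hc x ω, hc (x + r) ω]
    · have h1 : x ∉ Set.Icc 0 t := fun h => hx ⟨by linarith [h.1], by linarith [h.2]⟩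
      have h2 : x + r ∉ Set.Icc 0 t := fun h =>
        hx ⟨by linarith [h.1, hr.2], by linarith [h.2, hr.1]⟩
      simp [hs _ h1, hs _ h2]
  · rw [lintegral_indicator_const measurableSet_Icc, lintegral_const]
    simp [ENNReal.mul_eq_top]

/-- Sampling `f` at left endpoints of a grid preserves adaptedness. A fixed grid may be bad for a
merely measurable `f`, but the error averaged over the grid's offset is bounded by the `L²` modulus
of continuity, so a good offset exists. -/
lemma exists_simpleProcess_lintegral_le [IsProbabilityMeasure P] {f : ℝ≥0 → Ω → ℝ}
    (hm : Measurable (Function.uncurry f)) (ha : ∀ s, Measurable[F s] (f s)) {c : ℝ}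
    (hc : ∀ s ω, |f s ω| ≤ c) {t : ℝ≥0} (hs : ∀ s, t < s → ∀ ω, f s ω = 0) {ε : ℝ≥0∞}
    (hε : ε ≠ 0) : ∃ S : SimpleProcess F,
      ∫⁻ s, ∫⁻ ω, ‖S.val s ω - f s ω‖ₑ ^ 2 ∂P ∂(lebesgueIcc t) ≤ ε := by
  set g : ℝ → Ω → ℝ := fun x ω => (Set.Ici 0).indicator (fun x => f x.toNNReal ω) x with hg
  have hgm : Measurable (Function.uncurry g) := by
    have : Function.uncurry g = (Set.Ici (0 : ℝ) ×ˢ Set.univ).indicator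
        (fun p => Function.uncurry f (p.1.toNNReal, p.2)) := by
      ext p
      simp [hg, Set.indicator, Function.uncurry]
    rw [this]
    exact (hm.comp (by fun_prop)).indicator (measurableSet_Ici.prod MeasurableSet.univ)
  have hgc : ∀ x ω, |g x ω| ≤ c := fun x ω =>
    (norm_indicator_le_norm_self (fun x : ℝ => f x.toNNReal ω) x).trans (hc _ _)
  have hgf : ∀ (s : ℝ≥0) ω, g s ω = f s ω := fun s ω => by simp [hg]
  have hgs : ∀ x ∉ Set.Icc 0 (t : ℝ), ∀ ω, g x ω = 0 := by
    intro x hx ω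
    by_cases h0 : 0 ≤ x
    · lift x to ℝ≥0 using h0
      rw [hgf]
      refine hs _ (lt_of_not_ge fun h => hx ⟨x.2, NNReal.coe_le_coe.2 h⟩) ω
    · exact Set.indicator_of_notMem h0 _
  set K : ℝ → ℝ → ℝ≥0∞ := fun x y => ∫⁻ ω, ‖g x ω - g y ω‖ₑ ^ 2 ∂P
  have hK : Measurable (Function.uncurry K) := by
    refine Measurable.lintegral_prod_right' (f := fun q : (ℝ × ℝ) × Ω =>
      ‖g q.1.1 q.2 - g q.1.2 q.2‖ₑ ^ 2) ?_
    have h1 : Measurable fun q : (ℝ × ℝ) × Ω => g q.1.1 q.2 :=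
      hgm.comp (f := fun q : (ℝ × ℝ) × Ω => (q.1.1, q.2)) (by fun_prop)
    have h2 : Measurable fun q : (ℝ × ℝ) × Ω => g q.1.2 q.2 :=
      hgm.comp (f := fun q : (ℝ × ℝ) × Ω => (q.1.2, q.2)) (by fun_prop)
    exact ((h1.sub h2).enorm).pow_const 2
  have hε2 : 0 < ε / 2 := ENNReal.half_pos hε
  -- One half of `ε` pays for the sampling error, the other for the initial interval `[0, u]` with
  -- `u ≤ δ`, where the simple process is zero and `|f| ≤ c`.
  obtain ⟨δ, hδ, hδ1, hδ2⟩ : ∃ δ : ℝ, 0 < δ ∧ (∀ r ∈ Set.Ioc 0 δ, ∫⁻ x, K x (x + r) ≤ ε / 2) ∧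
      ENNReal.ofReal c ^ 2 * ENNReal.ofReal δ ≤ ε / 2 := by
    have h1 := (tendsto_lintegral_lintegral_sub_translate (P := P) hgm hgc hgs).eventually_le_const
      hε2
    have h2 : Tendsto (fun δ : ℝ => ENNReal.ofReal c ^ 2 * ENNReal.ofReal δ) (𝓝 0) (𝓝 0) := by
      have := ENNReal.Tendsto.const_mul (a := ENNReal.ofReal c ^ 2)
        ((ENNReal.continuous_ofReal.tendsto 0)) (Or.inr (by simp))
      simpa using this
    obtain ⟨ρ, hρ, hρ'⟩ := Metric.eventually_nhds_iff.1 (h1.and (h2.eventually_le_const hε2))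
    refine ⟨ρ / 2, by positivity, fun r hr => (hρ' ?_).1, (hρ' ?_).2⟩
    · rw [Real.dist_eq, sub_zero, abs_of_pos hr.1]
      linarith [hr.2]
    · rw [Real.dist_eq, sub_zero, abs_of_pos (by positivity)]
      linarith
  obtain ⟨N, hN⟩ := exists_nat_ge ((t : ℝ) / δ)
  rw [div_le_iff₀ hδ] at hN
  obtain ⟨u, hu, hle⟩ := exists_shift_le hK hδ hδ1 N
  lift δ to ℝ≥0 using hδ.le
  lift u to ℝ≥0 using hu.1.le
  let S : SimpleProcess F := SimpleProcess.sample f ha hc u δ N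
  refine ⟨S, ?_⟩
  have hSm : Measurable fun p : ℝ≥0 × Ω => ‖S.val p.1 p.2 - f p.1 p.2‖ₑ ^ 2 :=
    ((S.measurable_val.sub hm).enorm).pow_const 2
  rw [lebesgueIcc, lintegral_map hSm.lintegral_prod_right' measurable_real_toNNReal]
  set G : ℝ → ℝ≥0∞ := fun x => ∫⁻ ω, ‖S.val x.toNNReal ω - f x.toNNReal ω‖ₑ ^ 2 ∂P
  have hmono : Monotone fun k : ℕ => (u : ℝ) + (k : ℝ) * δ := fun k l hkl => by
    have : (k : ℝ) ≤ l := Nat.cast_le.2 hkl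
    dsimp only
    gcongr
  have htime : ∀ k, ((S.time k : ℝ≥0) : ℝ) = u + k * δ := fun k => by
    simp [S, SimpleProcess.sample]
  have hfirst : ∫⁻ x in Set.Icc 0 (u : ℝ), G x ≤ ε / 2 := by
    calc ∫⁻ x in Set.Icc 0 (u : ℝ), G x ≤ ∫⁻ x in Set.Icc 0 (u : ℝ), ENNReal.ofReal c ^ 2 := by
          refine setLIntegral_mono measurable_const fun x hx => ?_
          have hx' : x.toNNReal ≤ S.time 0 := by
            rw [Real.toNNReal_le_iff_le_coe, htime]
            simpa using hx.2
          calc G x ≤ ∫⁻ ω, ENNReal.ofReal c ^ 2 ∂P := by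
                refine lintegral_mono fun ω => ?_
                dsimp only
                rw [S.val_eq_zero hx', zero_sub, enorm_neg, Real.enorm_eq_ofReal_abs]
                gcongr
                exact hc _ _
            _ = ENNReal.ofReal c ^ 2 := by simp
      _ = ENNReal.ofReal c ^ 2 * ENNReal.ofReal u := by simp
      _ ≤ ENNReal.ofReal c ^ 2 * ENNReal.ofReal δ := by
          gcongr
          exact hu.2
      _ ≤ ε / 2 := hδ2
  have hrest : ∫⁻ x in Set.Ioc (u : ℝ) (u + N * δ), G x ≤ ε / 2 := by
    have := sum_setLIntegral_Ioc hmono G N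
    simp only [Nat.cast_zero, zero_mul, add_zero] at this
    rw [← this]
    refine le_trans (Finset.sum_le_sum fun k hk => ?_) hle
    refine setLIntegral_mono' measurableSet_Ioc fun x hx => ?_
    have hx0 : 0 ≤ x := le_trans (by positivity) hx.1.le
    lift x to ℝ≥0 using hx0
    have hx' : x ∈ Set.Ioc (S.time k) (S.time (k + 1)) := by
      rw [Set.mem_Ioc, ← NNReal.coe_lt_coe, ← NNReal.coe_le_coe, htime, htime]
      exact hx
    refine lintegral_mono fun ω => ?_
    dsimp only
    rw [Real.toNNReal_coe, S.val_eq_coeff (Finset.mem_range.1 hk) hx', hgf,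
      show (u : ℝ) + k * δ = ((u + k * δ : ℝ≥0) : ℝ) by push_cast; rfl, hgf]
    exact le_rfl
  calc ∫⁻ x in Set.Icc 0 (t : ℝ), G x
      ≤ ∫⁻ x in Set.Icc 0 (u : ℝ) ∪ Set.Ioc (u : ℝ) (u + N * δ), G x := by
        refine lintegral_mono_set fun x hx => ?_
        rcases le_or_gt x u with h | h
        · exact Or.inl ⟨hx.1, h⟩
        · exact Or.inr ⟨h, hx.2.trans (hN.trans (le_add_of_nonneg_left u.2))⟩
    _ ≤ ε / 2 + ε / 2 := (lintegral_union_le _ _ _).trans (add_le_add hfirst hrest)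
    _ = ε := ENNReal.add_halves ε

end Density

/-! ### The Itô integral of square integrable adapted processes -/

section AdaptedProcesses

variable {Ω : Type*} [mΩ : MeasurableSpace Ω] {P : Measure Ω} {F : Filtration ℝ≥0 mΩ}
  {f : ℝ≥0 → Ω → ℝ} {t : ℝ≥0}

/-- Measurable adapted processes in `L²([0, t] × Ω)`. -/
structure IsAdaptedL2 (F : Filtration ℝ≥0 mΩ) (P : Measure Ω) (t : ℝ≥0) (f : ℝ≥0 → Ω → ℝ) :
    Prop where
  measurable : Measurable (fun p : Set.Icc (0 : ℝ≥0) t × Ω => f p.1 p.2)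
  adapted : ∀ s ≤ t, Measurable[F s] (f s)
  lintegral_lt_top : ∫⁻ s, ∫⁻ ω, ‖f s ω‖ₑ ^ 2 ∂P ∂(lebesgueIcc t) < ∞

/-- The process `f` stopped from contributing after time `t`. -/
def cutoff (f : ℝ≥0 → Ω → ℝ) (t s : ℝ≥0) (ω : Ω) : ℝ := if s ≤ t then f s ω else 0

lemma ae_lebesgueIcc_le (t : ℝ≥0) : ∀ᵐ s ∂(lebesgueIcc t), s ≤ t := by
  have hs : MeasurableSet {s : ℝ≥0 | ¬ s ≤ t} :=
    (measurableSet_le measurable_id measurable_const).compl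
  rw [ae_iff, lebesgueIcc_apply hs]
  convert measure_empty (μ := volume)
  ext x
  simp only [Set.mem_inter_iff, Set.mem_preimage, Set.mem_ofPred_eq, not_le, Set.mem_Icc,
    Real.lt_toNNReal_iff_coe_lt, Set.mem_empty_iff_false, iff_false]
  rintro ⟨h1, -, h2⟩
  exact absurd h2 (not_le.2 h1)

lemma ae_prod_le [SFinite P] (t : ℝ≥0) : ∀ᵐ p ∂((lebesgueIcc t).prod P), p.1 ≤ t :=
  Measure.quasiMeasurePreserving_fst.ae (ae_lebesgueIcc_le t)

lemma cutoff_ae_eq [SFinite P] (f : ℝ≥0 → Ω → ℝ) (t : ℝ≥0) :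
    (fun p : ℝ≥0 × Ω => cutoff f t p.1 p.2) =ᵐ[(lebesgueIcc t).prod P] fun p => f p.1 p.2 := by
  filter_upwards [ae_prod_le t] with p hp
  exact if_pos hp

lemma IsAdaptedL2.measurable_cutoff (h : IsAdaptedL2 F P t f) :
    Measurable (Function.uncurry (cutoff f t)) := by
  -- Nothing is known about `f` after time `t`; stopping its time argument there makes it measurable
  -- on all of `ℝ≥0 × Ω`.
  have h1 : Measurable fun p : ℝ≥0 × Ω => f (min p.1 t) p.2 :=
    h.measurable.comp (f := fun p : ℝ≥0 × Ω =>
      ((⟨min p.1 t, bot_le, min_le_right _ _⟩ : Set.Icc (0 : ℝ≥0) t), p.2)) (by fun_prop)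
  have h2 : Function.uncurry (cutoff f t) =
      fun p => if p.1 ≤ t then f (min p.1 t) p.2 else 0 := by
    ext p
    by_cases hp : p.1 ≤ t <;> simp [Function.uncurry, cutoff, hp]
  rw [h2]
  exact Measurable.ite (measurableSet_le measurable_fst measurable_const) h1 measurable_const

lemma IsAdaptedL2.measurable_cutoff_apply (h : IsAdaptedL2 F P t f) (s : ℝ≥0) :
    Measurable[F s] (cutoff f t s) := by
  by_cases hs : s ≤ t
  · convert h.adapted s hs using 1
    ext ω
    simp [cutoff, hs]
  · convert measurable_const (a := (0 : ℝ)) using 1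
    ext ω
    simp [cutoff, hs]

lemma IsAdaptedL2.memLp [SFinite P] (h : IsAdaptedL2 F P t f) :
    MemLp (fun p : ℝ≥0 × Ω => f p.1 p.2) 2 ((lebesgueIcc t).prod P) := by
  refine (memLp_congr_ae (cutoff_ae_eq f t)).1
    ⟨h.measurable_cutoff.aestronglyMeasurable, ?_⟩
  rw [← ENNReal.pow_lt_top_iff.trans (or_iff_left two_ne_zero), eLpNorm_two_sq,
    lintegral_prod]
  swap
  · exact (h.measurable_cutoff.enorm.pow_const 2).aemeasurable
  refine lt_of_le_of_lt (lintegral_mono_ae ?_) h.lintegral_lt_top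
  filter_upwards [ae_lebesgueIcc_le t] with s hs
  refine lintegral_mono fun ω => ?_
  simp [cutoff, hs]

lemma exists_simpleProcess_eLpNorm_le_of_bounded [IsProbabilityMeasure P]
    (hm : Measurable (Function.uncurry f)) (ha : ∀ s, Measurable[F s] (f s)) {c : ℝ}
    (hc : ∀ s ω, |f s ω| ≤ c) (hs : ∀ s, t < s → ∀ ω, f s ω = 0) {ε : ℝ≥0∞} (hε : ε ≠ 0) :
    ∃ S : SimpleProcess F, eLpNorm (fun p : ℝ≥0 × Ω => S.val p.1 p.2 - f p.1 p.2) 2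
      ((lebesgueIcc t).prod P) ≤ ε := by
  obtain ⟨S, hS⟩ := exists_simpleProcess_lintegral_le (P := P) hm ha hc hs
    (pow_ne_zero 2 hε)
  refine ⟨S, ?_⟩
  rw [← ENNReal.pow_le_pow_left_iff two_ne_zero, eLpNorm_two_sq, lintegral_prod]
  · exact hS
  · exact ((S.measurable_val.sub hm).enorm.pow_const 2).aemeasurable

lemma tendsto_eLpNorm_truncation {α : Type*} [MeasurableSpace α] {μ : Measure α} {g : α → ℝ}
    (hg : MemLp g 2 μ) :
    Tendsto (fun n : ℕ => eLpNorm (fun x => max (-(n : ℝ)) (min n (g x)) - g x) 2 μ) atTop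
      (𝓝 0) := by
  have hpt : ∀ (n : ℕ) x, |max (-(n : ℝ)) (min n (g x)) - g x| ≤ |g x| := by
    intro n x
    have hn : (0 : ℝ) ≤ n := n.cast_nonneg
    rcases max_cases (-(n : ℝ)) (min n (g x)) with h | h <;>
      rcases min_cases (n : ℝ) (g x) with h' | h' <;>
      rcases abs_cases (g x) with h'' | h'' <;> rw [abs_le] <;> constructor <;> linarith
  have h2 : Tendsto (fun n : ℕ => ∫⁻ x, ‖max (-(n : ℝ)) (min n (g x)) - g x‖ₑ ^ 2 ∂μ) atTop
      (𝓝 (∫⁻ _, 0 ∂μ)) := by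
    refine tendsto_lintegral_of_dominated_convergence' (fun x => ‖g x‖ₑ ^ 2) (fun n => ?_)
      (fun n => ae_of_all _ fun x => ?_) ?_ (ae_of_all _ fun x => ?_)
    · exact (((aemeasurable_const.max (aemeasurable_const.min hg.1.aemeasurable)).sub
        hg.1.aemeasurable).enorm).pow_const 2
    · exact pow_le_pow_left' (enorm_le_iff_norm_le.2 (hpt n x)) 2
    · rw [← eLpNorm_two_sq]
      exact ENNReal.pow_ne_top hg.2.ne
    · refine tendsto_const_nhds.congr' ?_
      obtain ⟨N, hN⟩ := exists_nat_ge |g x|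
      filter_upwards [eventually_ge_atTop N] with n hn
      have h3 : |g x| ≤ n := hN.trans (Nat.cast_le.2 hn)
      rw [min_eq_right (abs_le.1 h3).2, max_eq_right (abs_le.1 h3).1]
      simp
  simp only [← eLpNorm_two_sq, lintegral_zero] at h2
  have h3 := (ENNReal.continuous_rpow_const (y := 1 / 2)).tendsto 0 |>.comp h2
  refine (h3.congr fun n => ?_).trans (by simp)
  rw [Function.comp_apply, ← ENNReal.rpow_natCast, ← ENNReal.rpow_mul]
  simp

/-- Clip at a high level `n`, then sample. Clipping preserves measurability and adaptedness and
fixes `0`, so the clipped process still vanishes after `t`. -/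
lemma IsAdaptedL2.exists_simpleProcess_eLpNorm_le [IsProbabilityMeasure P]
    (h : IsAdaptedL2 F P t f) {ε : ℝ≥0∞} (hε : ε ≠ 0) :
    ∃ S : SimpleProcess F, eLpNorm (fun p : ℝ≥0 × Ω => S.val p.1 p.2 - f p.1 p.2) 2
      ((lebesgueIcc t).prod P) ≤ ε := by
  have hε2 : 0 < ε / 2 := ENNReal.half_pos hε
  have hg : MemLp (fun p : ℝ≥0 × Ω => cutoff f t p.1 p.2) 2 ((lebesgueIcc t).prod P) :=
    (memLp_congr_ae (cutoff_ae_eq f t)).2 h.memLp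
  obtain ⟨n, hn⟩ := ((tendsto_eLpNorm_truncation hg).eventually_le_const hε2).exists
  let φ : ℝ → ℝ := fun x => max (-(n : ℝ)) (min n x)
  have hφ : Measurable φ := measurable_const.max (measurable_const.min measurable_id)
  obtain ⟨S, hS⟩ := exists_simpleProcess_eLpNorm_le_of_bounded (P := P) (t := t)
    (f := fun s ω => φ (cutoff f t s ω)) (c := n) (hφ.comp h.measurable_cutoff)
    (fun s => hφ.comp (h.measurable_cutoff_apply s)) (fun s ω => by
      have : (0 : ℝ) ≤ n := n.cast_nonneg
      exact abs_le.2 ⟨le_max_left _ _, max_le (by linarith) (min_le_left _ _)⟩)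
    (fun s hs ω => by simp [φ, cutoff, not_le.2 hs]) hε2.ne'
  refine ⟨S, ?_⟩
  calc eLpNorm (fun p : ℝ≥0 × Ω => S.val p.1 p.2 - f p.1 p.2) 2 ((lebesgueIcc t).prod P)
      = eLpNorm ((fun p : ℝ≥0 × Ω => S.val p.1 p.2 - φ (cutoff f t p.1 p.2)) +
          fun p => φ (cutoff f t p.1 p.2) - cutoff f t p.1 p.2) 2 ((lebesgueIcc t).prod P) := by
        refine eLpNorm_congr_ae ?_
        filter_upwards [cutoff_ae_eq f t] with p hp
        simp only [Pi.add_apply, ← hp]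
        ring
    _ ≤ ε / 2 + ε / 2 := by
        refine (eLpNorm_add_le ?_ ?_ one_le_two).trans (add_le_add hS hn)
        · exact (S.measurable_val.sub (hφ.comp h.measurable_cutoff)).aestronglyMeasurable
        · exact ((hφ.comp h.measurable_cutoff).sub h.measurable_cutoff).aestronglyMeasurable
    _ = ε := ENNReal.add_halves ε

lemma inner_toLp {α : Type*} [MeasurableSpace α] {μ : Measure α} {f g : α → ℝ}
    (hf : MemLp f 2 μ) (hg : MemLp g 2 μ) :
    inner ℝ (hf.toLp f) (hg.toLp g) = ∫ x, f x * g x ∂μ := by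
  rw [L2.inner_def]
  refine integral_congr_ae ?_
  filter_upwards [hf.coeFn_toLp, hg.coeFn_toLp] with x h1 h2
  simp [h1, h2, mul_comm]

lemma covariance_congr_ae {X X' Y Y' : Ω → ℝ} (hX : X =ᵐ[P] X') (hY : Y =ᵐ[P] Y') :
    cov[X, Y; P] = cov[X', Y'; P] := by
  rw [covariance, covariance, integral_congr_ae hX, integral_congr_ae hY]
  refine integral_congr_ae ?_
  filter_upwards [hX, hY] with ω h1 h2
  rw [h1, h2]

/-- A simple process as an element of `L²([0, t] × Ω)`. -/
def SimpleProcess.valLp [IsFiniteMeasure P] (S : SimpleProcess F) (t : ℝ≥0) :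
    Lp ℝ 2 ((lebesgueIcc t).prod P) :=
  (S.memLp_val t).toLp _

end AdaptedProcesses

/-! ### Itô isometry, existence and uniqueness of the real integrals -/

section ItoIntegral

variable {Ω : Type*} [mΩ : MeasurableSpace Ω] {P : Measure Ω}
  {F : Filtration ℝ≥0 mΩ} {U : Type*} [NormedAddCommGroup U] [NormedSpace ℝ U]
  [CompleteSpace U] {W : ℝ≥0 → CylindricalRV P U} {f g : ℝ≥0 → Ω → ℝ} {t : ℝ≥0}

/-- Since `W(0) = 0` almost surely, the increment over `[0, 1]` is `W(1)`, whose covariance is `Q`.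
-/
lemma IsStronglyCylindricalWiener.exists_isWienerProcess (hW : IsStronglyCylindricalWiener F W)
    (u u' : StrongDual ℝ U) : ∃ C : Matrix (Fin 2) (Fin 2) ℝ,
      IsWienerProcess F P (fun t ω i => W t (![u, u'] i) ω) C ∧ C 0 1 = u' (hW.Q.op u) := by
  obtain ⟨C, hC⟩ := hW.weak 2 ![u, u']
  refine ⟨C, hC, ?_⟩
  have h1 := hC.covariance 0 1 zero_le_one 0 1
  rw [NNReal.coe_one, NNReal.coe_zero, sub_zero, one_mul] at h1
  rw [← h1]
  refine Eq.trans ?_ (hW.strong.apply_covOp u u').symm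
  have h0 := hC.ae_zero 0
  have h0' := hC.ae_zero 1
  refine covariance_congr_ae ?_ ?_
  · filter_upwards [h0] with ω hω
    simpa using hω
  · filter_upwards [h0'] with ω hω
    simpa using hω

variable [IsProbabilityMeasure P]

lemma IsStronglyCylindricalWiener.memLp_integral (hW : IsStronglyCylindricalWiener F W)
    (u : StrongDual ℝ U) (S : SimpleProcess F) (t : ℝ≥0) :
    MemLp (S.integral (fun s => W s u) t) 2 P := by
  obtain ⟨C, hC, -⟩ := hW.exists_isWienerProcess u u
  exact S.memLp_integral hC t 0

/-- The elementary integral of a simple process as an element of `L²(Ω)`. -/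
def IsStronglyCylindricalWiener.integralLp (hW : IsStronglyCylindricalWiener F W)
    (u : StrongDual ℝ U) (t : ℝ≥0) (S : SimpleProcess F) : Lp ℝ 2 P :=
  (hW.memLp_integral u S t).toLp _

lemma IsStronglyCylindricalWiener.inner_integralLp (hW : IsStronglyCylindricalWiener F W)
    (u u' : StrongDual ℝ U) (t : ℝ≥0) (S S' : SimpleProcess F) :
    inner ℝ (hW.integralLp u t S) (hW.integralLp u' t S') =
      u' (hW.Q.op u) * inner ℝ (S.valLp (P := P) t) (S'.valLp t) := by
  obtain ⟨C, hC, h01⟩ := hW.exists_isWienerProcess u u'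
  rw [IsStronglyCylindricalWiener.integralLp, IsStronglyCylindricalWiener.integralLp, inner_toLp,
    SimpleProcess.valLp, SimpleProcess.valLp, inner_toLp, ← h01]
  exact SimpleProcess.integral_mul_integral hC S S' t 0 1

lemma IsStronglyCylindricalWiener.isItoIntegral_iff (hW : IsStronglyCylindricalWiener F W)
    (u : StrongDual ℝ U) (hf : MemLp (fun p : ℝ≥0 × Ω => f p.1 p.2) 2 ((lebesgueIcc t).prod P))
    (Y : Lp ℝ 2 P) :
    IsItoIntegral F P (fun s => W s u) t f Y ↔ ∃ S : ℕ → SimpleProcess F,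
      Tendsto (fun n => (S n).valLp (P := P) t) atTop (𝓝 (hf.toLp _)) ∧
      Tendsto (fun n => hW.integralLp u t (S n)) atTop (𝓝 Y) := by
  refine exists_congr fun S => and_congr ?_ ?_
  · exact (Lp.tendsto_Lp_iff_tendsto_eLpNorm'' _ (fun n => (S n).memLp_val t) _ hf).symm
  · have := (Lp.tendsto_Lp_iff_tendsto_eLpNorm'' (fi := atTop) _
      (fun n => hW.memLp_integral u (S n) t) _ (Lp.memLp Y)).symm
    rw [Lp.toLp_coeFn] at this
    exact this

/-- The Itô isometry for the integrals with respect to the processes `W(·)u` and `W(·)u'`. -/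
lemma IsStronglyCylindricalWiener.inner_eq (hW : IsStronglyCylindricalWiener F W)
    {u u' : StrongDual ℝ U} (hf : MemLp (fun p : ℝ≥0 × Ω => f p.1 p.2) 2 ((lebesgueIcc t).prod P))
    (hg : MemLp (fun p : ℝ≥0 × Ω => g p.1 p.2) 2 ((lebesgueIcc t).prod P)) {Y Z : Lp ℝ 2 P}
    (hY : IsItoIntegral F P (fun s => W s u) t f Y)
    (hZ : IsItoIntegral F P (fun s => W s u') t g Z) :
    inner ℝ Y Z = u' (hW.Q.op u) * inner ℝ (hf.toLp _) (hg.toLp _) := by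
  obtain ⟨S, h1, h2⟩ := (hW.isItoIntegral_iff u hf Y).1 hY
  obtain ⟨S', h3, h4⟩ := (hW.isItoIntegral_iff u' hg Z).1 hZ
  refine tendsto_nhds_unique (h2.inner h4) ?_
  simp_rw [hW.inner_integralLp]
  exact (h1.inner h3).const_mul _

/-- By the isometry, all four inner products in the expansion of `‖Y - Z‖²` have the same value. -/
lemma IsStronglyCylindricalWiener.isItoIntegral_unique (hW : IsStronglyCylindricalWiener F W)
    {u : StrongDual ℝ U} (hf : MemLp (fun p : ℝ≥0 × Ω => f p.1 p.2) 2 ((lebesgueIcc t).prod P))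
    {Y Z : Lp ℝ 2 P} (hY : IsItoIntegral F P (fun s => W s u) t f Y)
    (hZ : IsItoIntegral F P (fun s => W s u) t f Z) : Y = Z := by
  rw [← sub_eq_zero, ← inner_self_eq_zero (𝕜 := ℝ), inner_sub_left, inner_sub_right,
    inner_sub_right, hW.inner_eq hf hf hY hY, hW.inner_eq hf hf hY hZ, hW.inner_eq hf hf hZ hY,
    hW.inner_eq hf hf hZ hZ]
  simp

lemma IsStronglyCylindricalWiener.exists_isItoIntegral (hW : IsStronglyCylindricalWiener F W)
    (u : StrongDual ℝ U) (hf : IsAdaptedL2 F P t f) :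
    ∃ Y, IsItoIntegral F P (fun s => W s u) t f Y := by
  have hex : ∀ n : ℕ, ∃ S : SimpleProcess F,
      eLpNorm (fun p : ℝ≥0 × Ω => S.val p.1 p.2 - f p.1 p.2) 2 ((lebesgueIcc t).prod P) ≤
        ((n : ℝ≥0∞) + 1)⁻¹ := fun n =>
    hf.exists_simpleProcess_eLpNorm_le (by simp)
  choose S hS using hex
  have h0 : Tendsto (fun n => eLpNorm (fun p : ℝ≥0 × Ω => (S n).val p.1 p.2 - f p.1 p.2) 2
      ((lebesgueIcc t).prod P)) atTop (𝓝 0) := by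
    refine tendsto_of_tendsto_of_tendsto_of_le_of_le tendsto_const_nhds ?_
      (fun n => zero_le) hS
    have := (tendsto_add_atTop_iff_nat 1).2 ENNReal.tendsto_inv_nat_nhds_zero
    simpa using this
  have h1 : Tendsto (fun n => (S n).valLp (P := P) t) atTop (𝓝 (hf.memLp.toLp _)) :=
    (Lp.tendsto_Lp_iff_tendsto_eLpNorm'' _ (fun n => (S n).memLp_val t) _ hf.memLp).2 h0
  have hnorm : ∀ n m, ‖hW.integralLp u t (S n) - hW.integralLp u t (S m)‖ ^ 2 =
      u (hW.Q.op u) * ‖(S n).valLp (P := P) t - (S m).valLp t‖ ^ 2 := by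
    intro n m
    simp only [← real_inner_self_eq_norm_sq, inner_sub_left, inner_sub_right,
      hW.inner_integralLp]
    ring
  have h2 : CauchySeq fun n => hW.integralLp u t (S n) := by
    rw [Metric.cauchySeq_iff']
    intro ε hε
    have hq := hW.Q.nonneg u
    have hc := h1.cauchySeq
    rw [Metric.cauchySeq_iff'] at hc
    -- The summand `1` keeps the divisor positive when `⟨Qu,u⟩ = 0`.
    obtain ⟨N, hN⟩ := hc (ε / (Real.sqrt (u (hW.Q.op u)) + 1)) (by positivity)
    refine ⟨N, fun n hn => ?_⟩
    have h3 := hN n hn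
    rw [dist_eq_norm] at h3 ⊢
    rw [lt_div_iff₀ (by positivity)] at h3
    refine lt_of_le_of_lt ?_ h3
    refine abs_le_of_sq_le_sq' ?_ (by positivity) |>.2
    rw [hnorm, mul_pow, mul_comm]
    gcongr
    nlinarith [Real.sq_sqrt hq, Real.sqrt_nonneg (u (hW.Q.op u))]
  obtain ⟨Y, hY⟩ := cauchySeq_tendsto_of_complete h2
  exact ⟨Y, (hW.isItoIntegral_iff u hf.memLp Y).2 ⟨S, h1, hY⟩⟩

lemma IsStronglyCylindricalWiener.isItoIntegral_itoIntegral
    (hW : IsStronglyCylindricalWiener F W) (u : StrongDual ℝ U) (hf : IsAdaptedL2 F P t f) :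
    IsItoIntegral F P (fun s => W s u) t f (itoIntegral F P (fun s => W s u) t f) := by
  have h := hW.exists_isItoIntegral u hf
  rw [itoIntegral, dif_pos h]
  exact Classical.choose_spec h

end ItoIntegral

/-! ### The cylindrical stochastic integral -/

section Hilbert

lemma norm_sum_sq_of_pairwise_inner_eq_zero {ι E : Type*} [NormedAddCommGroup E]
    [InnerProductSpace ℝ E] {x : ι → E} (hx : ∀ k l, k ≠ l → inner ℝ (x k) (x l) = 0)
    (s : Finset ι) : ‖∑ k ∈ s, x k‖ ^ 2 = ∑ k ∈ s, ‖x k‖ ^ 2 := by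
  rw [← real_inner_self_eq_norm_sq, sum_inner]
  refine Finset.sum_congr rfl fun k hk => ?_
  rw [inner_sum, Finset.sum_eq_single_of_mem k hk fun l _ hlk => hx k l hlk.symm,
    real_inner_self_eq_norm_sq]

/-- By Pythagoras, the Cauchy criterion for `∑ ‖x k‖²` over finite sets is the one for `∑ x k`. -/
lemma summable_of_pairwise_inner_eq_zero {ι E : Type*} [NormedAddCommGroup E]
    [InnerProductSpace ℝ E] [CompleteSpace E] {x : ι → E}
    (hx : ∀ k l, k ≠ l → inner ℝ (x k) (x l) = 0) (hs : Summable fun k => ‖x k‖ ^ 2) :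
    Summable x := by
  rw [summable_iff_vanishing_norm]
  intro ε hε
  obtain ⟨s, hs⟩ := summable_iff_vanishing_norm.1 hs (ε ^ 2) (by positivity)
  refine ⟨s, fun r hr => ?_⟩
  have h := (le_abs_self _).trans_lt (hs r hr)
  rw [← norm_sum_sq_of_pairwise_inner_eq_zero hx] at h
  exact lt_of_pow_lt_pow_left₀ 2 hε.le h

lemma norm_toLp_sq {α : Type*} [MeasurableSpace α] {μ : Measure α} {f : α → ℝ}
    (hf : MemLp f 2 μ) : ‖hf.toLp f‖ ^ 2 = (∫⁻ x, ‖f x‖ₑ ^ 2 ∂μ).toReal := by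
  rw [Lp.norm_toLp, ← eLpNorm_two_sq, ENNReal.toReal_pow]

variable {U : Type*} [NormedAddCommGroup U] [NormedSpace ℝ U] [CompleteSpace U] (Q : PosSymmOp U)

/-- Both sides have the same inner product with every element of the dense range of `Q`. -/
lemma PosSymmOp.iQadj_eq (u : StrongDual ℝ U) : Q.iQadj u = (Q.toRan u : Q.H) := by
  refine ext_inner_left ℝ fun h => ?_
  rw [Q.inner_iQadj]
  induction h using UniformSpace.Completion.induction_on with
  | hp => exact isClosed_eq (by fun_prop) (by fun_prop)
  | ih x =>
    rw [Q.iQ_coe, UniformSpace.Completion.inner_coe]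
    exact Q.apply_eq_of_op_eq x (by rw [Q.op_lift, Q.ranIncl_toRan])

lemma PosSymmOp.iQ_iQadj (u : StrongDual ℝ U) : Q.iQ (Q.iQadj u) = Q.op u := by
  rw [Q.iQadj_eq, Q.iQ_coe, Q.ranIncl_toRan]

/-- This turns the covariance of `B_k(1)` and `B_l(1)` into `[e_k, e_l]`. -/
lemma PosSymmOp.apply_op_eq_inner (u u' : StrongDual ℝ U) :
    u' (Q.op u) = inner ℝ (Q.iQadj u) (Q.iQadj u') := by
  rw [Q.inner_iQadj, Q.iQ_iQadj]

lemma PosSymmOp.norm_iQadj_le (u : StrongDual ℝ U) : ‖Q.iQadj u‖ ≤ ‖Q.iQ‖ * ‖u‖ := by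
  rw [PosSymmOp.iQadj, LinearIsometryEquiv.norm_map, mul_comm]
  exact u.opNorm_comp_le _

/-- Bessel's inequality for the coordinates `⟨i_Q e_k, u*⟩`. -/
lemma PosSymmOp.sum_sq_apply_iQ_le {ι : Type*} {e : ι → Q.H} (he : Orthonormal ℝ e)
    (s : Finset ι) (u : StrongDual ℝ U) :
    ∑ k ∈ s, ‖u (Q.iQ (e k))‖ ^ 2 ≤ (‖Q.iQ‖ * ‖u‖) ^ 2 := by
  simp_rw [← Q.inner_iQadj]
  exact (he.sum_inner_products_le _).trans
    (pow_le_pow_left₀ (norm_nonneg _) (Q.norm_iQadj_le u) 2)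

end Hilbert

/-! ### Integrands of class `MT` as elements of `L²([0, t] × Ω)` -/

section Integrands

variable {Ω : Type*} [mΩ : MeasurableSpace Ω] {P : Measure Ω} {F : Filtration ℝ≥0 mΩ}
  {U : Type*} [NormedAddCommGroup U] [NormedSpace ℝ U]
  {V : Type*} [NormedAddCommGroup V] [NormedSpace ℝ V]
  {T t : ℝ≥0} {Φ : ℝ≥0 → Ω → (U →L[ℝ] V)}

lemma lebesgueIcc_mono (ht : t ≤ T) : lebesgueIcc t ≤ lebesgueIcc T :=
  Measure.map_mono (Measure.restrict_mono (Set.Icc_subset_Icc_right (NNReal.coe_le_coe.2 ht))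
    le_rfl) measurable_real_toNNReal

lemma enorm_apply_apply_sq_le (L : U →L[ℝ] V) (v : StrongDual ℝ V) (y : U) :
    ‖v (L y)‖ₑ ^ 2 ≤ ‖y‖ₑ ^ 2 * ‖(v.comp L : StrongDual ℝ U)‖ₑ ^ 2 := by
  rw [← mul_pow, mul_comm]
  exact pow_le_pow_left' ((v.comp L).le_opENorm y) 2

lemma MT.lintegral_lt_top (hΦ : MT F P T Φ) (ht : t ≤ T) (v : StrongDual ℝ V) :
    ∫⁻ s, ∫⁻ ω, ‖(v.comp (Φ s ω) : StrongDual ℝ U)‖ₑ ^ 2 ∂P ∂(lebesgueIcc t) < ∞ :=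
  (lintegral_mono' (lebesgueIcc_mono ht) le_rfl).trans_lt (hΦ.square_integrable v)

lemma MT.isAdaptedL2 (hΦ : MT F P T Φ) (ht : t ≤ T) (v : StrongDual ℝ V) (y : U) :
    IsAdaptedL2 F P t fun s ω => v (Φ s ω y) where
  measurable := by
    have h1 : Measurable fun p : Set.Icc (0 : ℝ≥0) t × Ω =>
        ((⟨p.1, p.1.2.1, p.1.2.2.trans ht⟩ : Set.Icc (0 : ℝ≥0) T), p.2) := by fun_prop
    exact (ContinuousLinearMap.apply ℝ ℝ y).continuous.measurable.comp ((hΦ.measurable v).comp h1)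
  adapted s hs := (ContinuousLinearMap.apply ℝ ℝ y).continuous.measurable.comp
    (hΦ.adapted v s (hs.trans ht))
  lintegral_lt_top := by
    calc ∫⁻ s, ∫⁻ ω, ‖v (Φ s ω y)‖ₑ ^ 2 ∂P ∂(lebesgueIcc t)
        ≤ ∫⁻ s, ∫⁻ ω, ‖y‖ₑ ^ 2 * ‖(v.comp (Φ s ω) : StrongDual ℝ U)‖ₑ ^ 2 ∂P
            ∂(lebesgueIcc t) :=
          lintegral_mono fun s => lintegral_mono fun ω => enorm_apply_apply_sq_le _ _ _
      _ = ‖y‖ₑ ^ 2 * ∫⁻ s, ∫⁻ ω, ‖(v.comp (Φ s ω) : StrongDual ℝ U)‖ₑ ^ 2 ∂P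
            ∂(lebesgueIcc t) := by
          have h : ‖y‖ₑ ^ 2 ≠ ∞ := by simp
          simp_rw [lintegral_const_mul' _ _ h]
      _ < ∞ := ENNReal.mul_lt_top (by simp) (hΦ.lintegral_lt_top ht v)

/-- This direction of Tonelli's theorem needs no joint measurability, which `Φ` has only on `[0,
T]`. -/
lemma MT.lintegral_prod_lt_top [SFinite P] (hΦ : MT F P T Φ) (ht : t ≤ T) (v : StrongDual ℝ V) :
    ∫⁻ p, ‖(v.comp (Φ p.1 p.2) : StrongDual ℝ U)‖ₑ ^ 2 ∂((lebesgueIcc t).prod P) < ∞ :=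
  (lintegral_prod_le _).trans_lt (hΦ.lintegral_lt_top ht v)

/-- The process `⟨Φ(s)y, v*⟩` as an element of `L²([0, t] × Ω)`, depending on `y`. -/
def MT.applyLp [SFinite P] (hΦ : MT F P T Φ) (ht : t ≤ T) (v : StrongDual ℝ V) :
    U →L[ℝ] Lp ℝ 2 ((lebesgueIcc t).prod P) :=
  LinearMap.mkContinuous
    { toFun := fun y => (hΦ.isAdaptedL2 ht v y).memLp.toLp _
      map_add' := fun y z => by
        rw [← MemLp.toLp_add]
        refine MemLp.toLp_congr _ _ (ae_of_all _ fun p => ?_)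
        simp
      map_smul' := fun c y => by
        rw [RingHom.id_apply, ← MemLp.toLp_const_smul]
        refine MemLp.toLp_congr _ _ (ae_of_all _ fun p => ?_)
        simp }
    (Real.sqrt (∫⁻ p, ‖(v.comp (Φ p.1 p.2) : StrongDual ℝ U)‖ₑ ^ 2
      ∂((lebesgueIcc t).prod P)).toReal)
    (fun y => by
      refine abs_le_of_sq_le_sq' ?_ (by positivity) |>.2
      rw [mul_pow, Real.sq_sqrt ENNReal.toReal_nonneg]
      change ‖(hΦ.isAdaptedL2 ht v y).memLp.toLp _‖ ^ 2 ≤ _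
      rw [norm_toLp_sq, ← toReal_enorm, ← ENNReal.toReal_pow, ← ENNReal.toReal_mul, mul_comm,
        ← lintegral_const_mul' _ _ (by simp)]
      refine ENNReal.toReal_mono ?_ (lintegral_mono fun p => enorm_apply_apply_sq_le _ _ _)
      rw [lintegral_const_mul' _ _ (by simp)]
      exact (ENNReal.mul_lt_top (by simp) (hΦ.lintegral_prod_lt_top ht v)).ne)

lemma MT.applyLp_apply [SFinite P] (hΦ : MT F P T Φ) (ht : t ≤ T) (v : StrongDual ℝ V) (y : U) :
    hΦ.applyLp ht v y = (hΦ.isAdaptedL2 ht v y).memLp.toLp _ := rfl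

lemma MT.applyLp_add [SFinite P] (hΦ : MT F P T Φ) (ht : t ≤ T) (v w : StrongDual ℝ V) :
    hΦ.applyLp ht (v + w) = hΦ.applyLp ht v + hΦ.applyLp ht w := by
  ext1 y
  rw [add_apply, hΦ.applyLp_apply, hΦ.applyLp_apply, hΦ.applyLp_apply,
    ← MemLp.toLp_add]
  exact MemLp.toLp_congr _ _ (ae_of_all _ fun p => by simp)

lemma MT.applyLp_smul [SFinite P] (hΦ : MT F P T Φ) (ht : t ≤ T) (c : ℝ) (v : StrongDual ℝ V) :
    hΦ.applyLp ht (c • v) = c • hΦ.applyLp ht v := by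
  ext1 y
  rw [smul_apply, hΦ.applyLp_apply, hΦ.applyLp_apply, ← MemLp.toLp_const_smul]
  exact MemLp.toLp_congr _ _ (ae_of_all _ fun p => by simp)

/-- Bessel's inequality, applied to `Φ^*v*` at each `(s, ω)` and then integrated, bounds all finite
partial sums at once. -/
lemma MT.summable_norm_applyLp_sq [SFinite P] [CompleteSpace U] (hΦ : MT F P T Φ) (ht : t ≤ T)
    (v : StrongDual ℝ V) (Q : PosSymmOp U) {ι : Type*} {e : ι → Q.H} (he : Orthonormal ℝ e) :
    Summable fun k => ‖hΦ.applyLp ht v (Q.iQ (e k))‖ ^ 2 := by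
  set A := ∫⁻ p, ENNReal.ofReal (‖Q.iQ‖ ^ 2) * ‖(v.comp (Φ p.1 p.2) : StrongDual ℝ U)‖ₑ ^ 2
    ∂((lebesgueIcc t).prod P) with hA
  have hAfin : A ≠ ∞ := by
    rw [hA, lintegral_const_mul' _ _ (by simp)]
    exact (ENNReal.mul_lt_top (by simp) (hΦ.lintegral_prod_lt_top ht v)).ne
  refine summable_of_sum_le (c := A.toReal) (fun k => by positivity) fun s => ?_
  have hm : ∀ k, MemLp (fun p : ℝ≥0 × Ω => v (Φ p.1 p.2 (Q.iQ (e k)))) 2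
    ((lebesgueIcc t).prod P) := fun k => (hΦ.isAdaptedL2 ht v _).memLp
  simp_rw [hΦ.applyLp_apply, norm_toLp_sq]
  rw [← ENNReal.toReal_sum, ← lintegral_finsetSum']
  · refine ENNReal.toReal_mono hAfin (lintegral_mono fun p => ?_)
    have h := Q.sum_sq_apply_iQ_le he s (v.comp (Φ p.1 p.2))
    have h2 := ENNReal.ofReal_le_ofReal h
    rw [ENNReal.ofReal_sum_of_nonneg fun k _ => by positivity] at h2
    rw [mul_pow, ENNReal.ofReal_mul (by positivity)] at h2
    simp only [ENNReal.ofReal_pow, norm_nonneg, ofReal_norm] at h2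
    exact h2
  · exact fun k _ => (hm k).1.aemeasurable.enorm.pow_const 2
  · intro k _
    rw [← eLpNorm_two_sq]
    exact ENNReal.pow_ne_top (hm k).2.ne

end Integrands

/-! ### Characterization of the cylindrical integral without a basis -/

section CylindricalIntegral

variable {Ω : Type*} [mΩ : MeasurableSpace Ω] {P : Measure Ω}
  {F : Filtration ℝ≥0 mΩ} {U : Type*} [NormedAddCommGroup U] [NormedSpace ℝ U]
  [CompleteSpace U] {V : Type*} [NormedAddCommGroup V] [NormedSpace ℝ V]
  {W : ℝ≥0 → CylindricalRV P U} {T t : ℝ≥0} {Φ : ℝ≥0 → Ω → (U →L[ℝ] V)}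

/-- The characterization of `I ∈ L²(Ω)` as the stochastic integral of an integrand given by
`φ : U → L²([0, t] × Ω)`: it lies in the closed span of the real Itô integrals, and its inner
products with these are those given by the Itô isometry. -/
structure IsCylindricalIntegral (hW : IsStronglyCylindricalWiener F W) (t : ℝ≥0)
    (φ : U →L[ℝ] Lp ℝ 2 ((lebesgueIcc t).prod P)) (I : Lp ℝ 2 P) : Prop where
  inner_eq_zero : ∀ x : Lp ℝ 2 P, (∀ (w : StrongDual ℝ U) (g : ℝ≥0 → Ω → ℝ) (Z : Lp ℝ 2 P),
    MemLp (fun p : ℝ≥0 × Ω => g p.1 p.2) 2 ((lebesgueIcc t).prod P) →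
    IsItoIntegral F P (fun s => W s w) t g Z → inner ℝ x Z = 0) → inner ℝ x I = 0
  inner_eq : ∀ (w : StrongDual ℝ U) (g : ℝ≥0 → Ω → ℝ) (Z : Lp ℝ 2 P)
    (hg : MemLp (fun p : ℝ≥0 × Ω => g p.1 p.2) 2 ((lebesgueIcc t).prod P)),
    IsItoIntegral F P (fun s => W s w) t g Z →
      inner ℝ I Z = inner ℝ (φ (hW.Q.op w)) (hg.toLp _)

namespace IsCylindricalIntegral

variable {hW : IsStronglyCylindricalWiener F W} {φ ψ : U →L[ℝ] Lp ℝ 2 ((lebesgueIcc t).prod P)}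
  {I J : Lp ℝ 2 P}

/-- The difference `I - J` is orthogonal to all real Itô integrals, hence to `I` and `J`, hence to
itself. -/
lemma unique (hI : IsCylindricalIntegral hW t φ I) (hJ : IsCylindricalIntegral hW t φ J) :
    I = J := by
  have h : ∀ (w : StrongDual ℝ U) (g : ℝ≥0 → Ω → ℝ) (Z : Lp ℝ 2 P),
      MemLp (fun p : ℝ≥0 × Ω => g p.1 p.2) 2 ((lebesgueIcc t).prod P) →
      IsItoIntegral F P (fun s => W s w) t g Z → inner ℝ (I - J) Z = 0 := by
    intro w g Z hg hZ
    rw [inner_sub_left, hI.inner_eq w g Z hg hZ, hJ.inner_eq w g Z hg hZ, sub_self]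
  rw [← sub_eq_zero, ← inner_self_eq_zero (𝕜 := ℝ), inner_sub_right, hI.inner_eq_zero _ h,
    hJ.inner_eq_zero _ h, sub_self]

lemma add (hI : IsCylindricalIntegral hW t φ I) (hJ : IsCylindricalIntegral hW t ψ J) :
    IsCylindricalIntegral hW t (φ + ψ) (I + J) where
  inner_eq_zero x hx := by
    rw [inner_add_right, hI.inner_eq_zero x hx, hJ.inner_eq_zero x hx, add_zero]
  inner_eq w g Z hg hZ := by
    rw [inner_add_left, hI.inner_eq w g Z hg hZ, hJ.inner_eq w g Z hg hZ, add_apply,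
      inner_add_left]

lemma smul (c : ℝ) (hI : IsCylindricalIntegral hW t φ I) :
    IsCylindricalIntegral hW t (c • φ) (c • I) where
  inner_eq_zero x hx := by
    rw [real_inner_smul_right, hI.inner_eq_zero x hx, mul_zero]
  inner_eq w g Z hg hZ := by
    rw [real_inner_smul_left, hI.inner_eq w g Z hg hZ, smul_apply, real_inner_smul_left]

end IsCylindricalIntegral

variable [IsProbabilityMeasure P]

lemma SeriesRep.isItoIntegral_term (hW : IsStronglyCylindricalWiener F W) (hΦ : MT F P T Φ)
    (ht : t ≤ T) (R : SeriesRep hW.Q) (v : StrongDual ℝ V) (k : R.ι) :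
    IsItoIntegral F P (fun s => W s (R.u k)) t (fun s ω => v (Φ s ω (hW.Q.iQ (R.e k))))
      (R.term F W Φ t v k) :=
  hW.isItoIntegral_itoIntegral (R.u k) (hΦ.isAdaptedL2 ht v _)

lemma SeriesRep.inner_term (hW : IsStronglyCylindricalWiener F W) (hΦ : MT F P T Φ)
    (ht : t ≤ T) (R : SeriesRep hW.Q) (v : StrongDual ℝ V) (k l : R.ι) :
    inner ℝ (R.term F W Φ t v k) (R.term F W Φ t v l) = inner ℝ (R.e k) (R.e l) *
      inner ℝ (hΦ.applyLp ht v (hW.Q.iQ (R.e k))) (hΦ.applyLp ht v (hW.Q.iQ (R.e l))) := by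
  rw [hW.inner_eq (hΦ.isAdaptedL2 ht v _).memLp (hΦ.isAdaptedL2 ht v _).memLp
    (SeriesRep.isItoIntegral_term hW hΦ ht R v k) (SeriesRep.isItoIntegral_term hW hΦ ht R v l),
    hW.Q.apply_op_eq_inner, R.iQadj_u, R.iQadj_u]
  rfl

lemma SeriesRep.summable_term (hW : IsStronglyCylindricalWiener F W) (hΦ : MT F P T Φ)
    (ht : t ≤ T) (R : SeriesRep hW.Q) (v : StrongDual ℝ V) : Summable (R.term F W Φ t v) := by
  refine summable_of_pairwise_inner_eq_zero (fun k l hkl => ?_) ?_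
  · rw [SeriesRep.inner_term hW hΦ ht R v, R.e.orthonormal.inner_eq_zero hkl, zero_mul]
  · refine (hΦ.summable_norm_applyLp_sq ht v hW.Q R.e.orthonormal).congr fun k => ?_
    rw [← real_inner_self_eq_norm_sq, ← real_inner_self_eq_norm_sq,
      SeriesRep.inner_term hW hΦ ht R v,
      real_inner_self_eq_norm_sq (R.e k), R.e.orthonormal.norm_eq_one]
    simp

lemma SeriesRep.isCylindricalIntegral_I (hW : IsStronglyCylindricalWiener F W) (hΦ : MT F P T Φ)
    (ht : t ≤ T) (R : SeriesRep hW.Q) (v : StrongDual ℝ V) :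
    IsCylindricalIntegral hW t (hΦ.applyLp ht v) (R.I F W Φ t v) where
  inner_eq_zero x hx := by
    have h := (SeriesRep.summable_term hW hΦ ht R v).hasSum.mapL (innerSL ℝ x)
    refine h.unique ?_
    convert hasSum_zero with k
    exact hx _ _ _ (hΦ.isAdaptedL2 ht v _).memLp (SeriesRep.isItoIntegral_term hW hΦ ht R v k)
  inner_eq w g Z hg hZ := by
    have h := (SeriesRep.summable_term hW hΦ ht R v).hasSum.mapL (innerSL ℝ Z)
    -- Expand `i_Q^* w` in the basis and apply the continuous functional `h ↦ ⟨g, φ(i_Q h)⟩`. By the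
    -- isometry, the `k`-th term equals the inner product of `Z` with the `k`-th term of the series.
    have h' := (R.e.hasSum_repr (hW.Q.iQadj w)).mapL
      ((innerSL ℝ (hg.toLp _)).comp ((hΦ.applyLp ht v).comp hW.Q.iQ))
    rw [real_inner_comm, real_inner_comm (hg.toLp _), ← hW.Q.iQ_iQadj]
    refine h.unique ?_
    convert h' using 2 with k
    · rw [map_smul, R.e.repr_apply_apply, innerSL_apply_apply, real_inner_comm,
        hW.inner_eq (hΦ.isAdaptedL2 ht v _).memLp hg
          (SeriesRep.isItoIntegral_term hW hΦ ht R v k) hZ,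
        hW.Q.apply_op_eq_inner, R.iQadj_u, real_inner_comm (hg.toLp _)]
      rfl
    · rfl

end CylindricalIntegral

end CylindricalWiener

end

theorem mainTheorem5 {Ω : Type*} [mΩ : MeasurableSpace Ω] (P : Measure Ω) [IsProbabilityMeasure P]
    (F : Filtration ℝ≥0 mΩ)
    {U : Type*} [NormedAddCommGroup U] [NormedSpace ℝ U] [CompleteSpace U]
    [TopologicalSpace.SeparableSpace U]
    {V : Type*} [NormedAddCommGroup V] [NormedSpace ℝ V] [CompleteSpace V]
    [TopologicalSpace.SeparableSpace V]
    (W : ℝ≥0 → CylindricalRV P U) (hW : IsStronglyCylindricalWiener F W)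
    (T : ℝ≥0) (Φ : ℝ≥0 → Ω → (U →L[ℝ] V)) (hΦ : MT F P T Φ) (t : ℝ≥0) (ht : t ≤ T) :
    (∀ R : SeriesRep hW.Q,
      (∀ (v : StrongDual ℝ V) (k : R.ι),
        ∃! Y : Lp ℝ 2 P, IsItoIntegral F P (R.B W k) t (R.integrand Φ v k) Y) ∧
      (∀ v : StrongDual ℝ V, Summable (R.term F W Φ t v)) ∧
      ∃ X : CylindricalRV P V, ∀ v : StrongDual ℝ V, X v = (R.I F W Φ t v : Ω →ₘ[P] ℝ)) ∧
    (∀ R R' : SeriesRep hW.Q, ∀ v : StrongDual ℝ V, R.I F W Φ t v = R'.I F W Φ t v) := by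
  refine ⟨fun R => ⟨fun v k => ?_, fun v => R.summable_term hW hΦ ht v, ?_⟩, fun R R' v =>
    (R.isCylindricalIntegral_I hW hΦ ht v).unique (R'.isCylindricalIntegral_I hW hΦ ht v)⟩
  · exact ⟨_, R.isItoIntegral_term hW hΦ ht v k, fun Y hY => hW.isItoIntegral_unique
      (hΦ.isAdaptedL2 ht v _).memLp hY (R.isItoIntegral_term hW hΦ ht v k)⟩
  -- Both sides satisfy the characterization for the integrand belonging to `v + w`.
  · have hadd : ∀ v w, R.I F W Φ t (v + w) = R.I F W Φ t v + R.I F W Φ t w := fun v w =>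
      (R.isCylindricalIntegral_I hW hΦ ht (v + w)).unique
        (hΦ.applyLp_add ht v w ▸ (R.isCylindricalIntegral_I hW hΦ ht v).add
          (R.isCylindricalIntegral_I hW hΦ ht w))
    have hsmul : ∀ (c : ℝ) v, R.I F W Φ t (c • v) = c • R.I F W Φ t v := fun c v =>
      (R.isCylindricalIntegral_I hW hΦ ht (c • v)).unique
        (hΦ.applyLp_smul ht c v ▸ (R.isCylindricalIntegral_I hW hΦ ht v).smul c)
    exact ⟨{
      toFun := fun v => (R.I F W Φ t v : Ω →ₘ[P] ℝ)
      map_add' := fun v w => congrArg Subtype.val (hadd v w)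
      map_smul' := fun c v => congrArg Subtype.val (hsmul c v) }, fun _ => rfl⟩
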